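/- **Notation.** Let $n\ge 0$ and write $\sigma\in S_n$ as the word $\sigma(1)\cdots\sigma(n)$. For a word $w=x_1\cdots x_n$ of nonnegative integers let $\mathrm{DES}\,w=\{i: 1\le i\le n-1,\ x_i>x_{i+1}\}$, $\mathrm{maj}\,w=\sum_{i\in\mathrm{DES}\,w}i$, let $\mathrm{Zero}\,w=\{i:x_i=0\}$, $\mathrm{zero}\,w=\#\mathrm{Zero}\,w$, let $\mathrm{Pos}\,w$ be the subword of the positive letters of $w$, and put $\mathrm{mafz}\,w=\sum_{i\in\mathrm{Zero}\,w}i-\sum_{i=1}^{\mathrm{zero}\,w}i+\mathrm{maj}\,\mathrm{Pos}\,w$. For a word $v$ of positive letters, $\mathrm{Sh}(0^kv)$ is the set of all $w$ with $\mathrm{zero}\,w=k$ and $\mathrm{Pos}\,w=v$. For a permutation put $\mathrm{IDES}\,\sigma=\mathrm{DES}\,\sigma^{-1}$ and $\mathrm{imaj}\,\sigma=\mathrm{maj}\,\sigma^{-1}$. The reduction of a word without repetitions replaces its letters by $1,2,\dots$, preserving their order. *Fixed decomposition.* $\mathrm{FIX}\,\sigma$ is the set of fixed points, $\mathrm{fix}\,\sigma$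 its cardinality; $\mathrm{Der}\,\sigma\in S_m$, $m=n-\mathrm{fix}\,\sigma$, is the reduction of the subword of the non-fixed letters; $\mathrm{ZDer}\,\sigma$ is the word with $\mathrm{Zero}=\mathrm{FIX}\,\sigma$ and $\mathrm{Pos}=\mathrm{Der}\,\sigma$; $\mathrm{maz}\,\sigma=\mathrm{maj}\,\mathrm{ZDer}\,\sigma$ and $\mathrm{maf}\,\sigma=\sum_{i\in\mathrm{FIX}\,\sigma}i-\sum_{i=1}^{\mathrm{fix}\,\sigma}i+\mathrm{maj}\,\mathrm{Der}\,\sigma$. *Pixed decomposition.* A word $y_1\cdots y_n$ without repetitions is a desarrangement if $y_1>\cdots>y_{2k}$ and $y_{2k}<y_{2k+1}$ for some $k\ge1$ (with $y_{n+1}=\infty$). Write $\sigma=\sigma^p\sigma^d$, where $\sigma^d$ is the longest right factor of $\sigma$ that is a desarrangement (empty if there is none). $\mathrm{PIX}\,\sigma$ is the set of the letters of $\sigma^p$, $\mathrm{pix}\,\sigma$ its cardinality; $\mathrm{Desar}\,\sigma\in S_m$, $m=n-\mathrm{pix}\,\sigma$, is the reduction of $\sigma^d$; $\mathrm{ZDesar}\,\sigma$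 is the word with $\mathrm{Zero}=\mathrm{PIX}\,\sigma$ and $\mathrm{Pos}=(\mathrm{Desar}\,\sigma)^{-1}$; $\mathrm{mag}\,\sigma=\sum_{i\in\mathrm{PIX}\,\sigma}i-\sum_{i=1}^{\mathrm{pix}\,\sigma}i+\mathrm{imaj}\,\mathrm{Desar}\,\sigma$. Let $D_m=\{\sigma\in S_m:\mathrm{FIX}\,\sigma=\emptyset\}$, $K_m=\{\sigma\in S_m:\mathrm{PIX}\,\sigma=\emptyset\}$, and $$S_n^{\mathrm{Der}}=\bigcup_{0\le m\le n,\ v\in D_m}\mathrm{Sh}(0^{n-m}v),\qquad S_n^{\mathrm{Desar}}=\bigcup_{0\le m\le n,\ v^{-1}\in K_m}\mathrm{Sh}(0^{n-m}v).$$ *The transformation $\mathbf F_3$ on words.* For a word $u$ let $\rho(u)$ be the word obtained by shifting the positions of the zeros of $u$ cyclically one step to the right, with $\mathrm{Pos}\,\rho(u)=\mathrm{Pos}\,u$. Set $\mathbf F_3(\text{empty word})=\text{empty word}$ and, for a letter $x$, $\mathbf F_3(wx)=\rho(\mathbf F_3(w))\,x$ if $x=0$ or if $x$ is smaller than the last positive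 letter of $w$, and $\mathbf F_3(wx)=\mathbf F_3(w)\,x$ otherwise. Put $F_3=\mathrm{ZDer}^{-1}\circ\mathbf F_3\circ\mathrm{ZDer}$ and $F_3'=\mathrm{ZDesar}^{-1}\circ\mathbf F_3\circ\mathrm{ZDesar}$ on $S_n$. *The maps $DW^{\mathrm{loc}}$ and $\mathrm{dw}$.* Let $DW$ be a family of bijections $D_m\to K_m$ $(m\ge0)$ with $\mathrm{IDES}\circ DW=\mathrm{DES}$. Let $DW^{\mathrm{loc}}(\tau)$ be the permutation $\sigma\in S_n$ with $(\mathrm{PIX}\,\sigma,\mathrm{Desar}\,\sigma)=(\mathrm{FIX}\,\tau,DW(\mathrm{Der}\,\tau))$, and $\mathrm{dw}=\mathrm{ZDesar}\circ DW^{\mathrm{loc}}\circ\mathrm{ZDer}^{-1}$. **Theorem 1.3.** For every $n\ge0$: 1. On $S_n$ the triplets $(\mathrm{fix},\mathrm{maf},\mathrm{Der})$ and $(\mathrm{fix},\mathrm{maz},\mathrm{Der})$ are equidistributed, and so are $(\mathrm{pix},\mathrm{mag},\mathrm{Desar})$ and $(\mathrm{pix},\mathrm{imaj},\mathrm{Desar})$.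 2. The map $\mathbf F_3$ is a bijection of each shuffle class $\mathrm{Sh}(0^kv)$ onto itself with $\mathrm{mafz}\,\mathbf F_3(w)=\mathrm{maj}\,w$; the maps $\mathrm{ZDer}:S_n\to S_n^{\mathrm{Der}}$ and $\mathrm{ZDesar}:S_n\to S_n^{\mathrm{Desar}}$ are bijections; $\mathbf F_3$ is a bijection of $S_n^{\mathrm{Der}}$ and of $S_n^{\mathrm{Desar}}$ onto itself. Hence $F_3$ and $F_3'$ are well-defined bijections of $S_n$, with $\mathrm{ZDer}\circ F_3=\mathbf F_3\circ\mathrm{ZDer}$ and $\mathrm{ZDesar}\circ F_3'=\mathbf F_3\circ\mathrm{ZDesar}$, and for all $\sigma\in S_n$ $$(\mathrm{fix},\mathrm{maz},\mathrm{Der})\,\sigma=(\mathrm{fix},\mathrm{maf},\mathrm{Der})\,F_3(\sigma),\qquad(\mathrm{pix},\mathrm{imaj},\mathrm{Desar})\,\sigma=(\mathrm{pix},\mathrm{mag},\mathrm{Desar})\,F_3'(\sigma).$$ 3. Families $DW$ as above exist (Désarménien–Wachs). For every such family, $DW^{\mathrm{loc}}$ is a well-defined bijection of $S_n$ and $\mathrm{dw}$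 is a bijection of $S_n^{\mathrm{Der}}$ onto $S_n^{\mathrm{Desar}}$ with $\mathrm{Zero}\,\mathrm{dw}(w)=\mathrm{Zero}\,w$ and $\mathrm{Pos}\,\mathrm{dw}(w)=(DW(\mathrm{Pos}\,w))^{-1}$; moreover $$\mathrm{dw}\circ\mathrm{ZDer}=\mathrm{ZDesar}\circ DW^{\mathrm{loc}},\qquad \mathrm{dw}\circ\mathbf F_3=\mathbf F_3\circ\mathrm{dw}\ \text{ on } S_n^{\mathrm{Der}},\qquad DW^{\mathrm{loc}}\circ F_3=F_3'\circ DW^{\mathrm{loc}}\ \text{ on } S_n,$$ that is, the whole diagram of Fig. 2 commutes. -/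

import Mathlib

open Equiv

namespace FixMah

/-! ### Statistics on words

Words are lists of natural numbers; positions are counted from `1`. -/

/-- The descent set `{i : 1 ≤ i ≤ n - 1, x_i > x_{i+1}}` of the word `x_1 ⋯ x_n`. -/
def wDES (w : List ℕ) : Finset ℕ :=
  (Finset.Icc 1 (w.length - 1)).filter fun i => w.getD i 0 < w.getD (i - 1) 0

/-- The major index of a word. -/
def wmaj (w : List ℕ) : ℕ := ∑ i ∈ wDES w, i

/-- The longest subword of positive letters. -/
def Pos (w : List ℕ) : List ℕ := w.filter fun x => 0 < x

/-- The set of the positions of the letters equal to `0`. -/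
def Zero (w : List ℕ) : Finset ℕ :=
  (Finset.Icc 1 w.length).filter fun i => w.getD (i - 1) 0 = 0

/-- `mafz w = ∑_{i ∈ Zero w} i - ∑_{i=1}^{zero w} i + maj (Pos w)`.  The elements of `Zero w` are
distinct positive integers, so the subtraction never truncates. -/
def mafz (w : List ℕ) : ℕ :=
  (∑ i ∈ Zero w, i - ∑ i ∈ Finset.Icc 1 (Zero w).card, i) + wmaj (Pos w)

/-- The shuffle class of the words `0^k` and `v`: all rearrangements of `0^k v` whose longest
subword of positive letters is `v`. -/
def Sh (k : ℕ) (v : List ℕ) : Set (List ℕ) :=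
  {w | w.Perm (List.replicate k 0 ++ v) ∧ Pos w = v}

/-- The word `x_1 ⋯ x_n` with `x_i = 0` for `i ∈ Z`, the other letters being, from left to right,
the letters of `v`. -/
def shuf (n : ℕ) (Z : Finset ℕ) (v : List ℕ) : List ℕ :=
  (List.range' 1 n).map fun i =>
    if i ∈ Z then 0 else v.getD (((Finset.Icc 1 (i - 1)).filter fun j => j ∉ Z).card) 0

/-! ### The transformation `F₃` on words -/

/-- Shift the positions of the zeros cyclically one step to the right, without changing the subword
of positive letters: `u 0` becomes `0 u`, and a word `0^{r_1} v_1 0^{r_2} v_2 ⋯ 0^{r_m} v_m` that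
ends with a positive letter becomes `v_1 0^{r_1} v_2 0^{r_2} ⋯ v_m 0^{r_m}`. -/
def rot (u : List ℕ) : List ℕ :=
  shuf u.length ((Zero u).image fun i => if i = u.length then 1 else i + 1) (Pos u)

/-- One step of `F₃`: the letter `x` is appended, after a rotation of the zeros of `u` when `x = 0`
or `x` is smaller than the last positive letter of `u` (if there is one). -/
def F3step (u : List ℕ) (x : ℕ) : List ℕ :=
  (if x = 0 ∨ x < (Pos u).getLastD 0 then rot u else u) ++ [x]

/-- The transformation `F₃` on words, by induction on the length: `F₃` of the empty word is empty and
`F₃ (w x) = F3step (F₃ w) x`. -/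
def F3w (w : List ℕ) : List ℕ := w.foldl F3step []

/-! ### Statistics on permutations

The symmetric group `S_n` is `Perm (Fin n)`; the number `i` of `{1, …, n}` is the element `i - 1`
of `Fin n`. -/

/-- The word `σ(1) σ(2) ⋯ σ(n)`. -/
def word {n : ℕ} (σ : Perm (Fin n)) : List ℕ := List.ofFn fun i => (σ i : ℕ) + 1

/-- The set of fixed points. -/
def FIX {n : ℕ} (σ : Perm (Fin n)) : Finset ℕ :=
  (Finset.univ.filter fun i : Fin n => σ i = i).image fun i : Fin n => (i : ℕ) + 1

/-- The number of fixed points. -/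
def fix {n : ℕ} (σ : Perm (Fin n)) : ℕ := (FIX σ).card

/-- The descent set. -/
def DES {n : ℕ} (σ : Perm (Fin n)) : Finset ℕ := wDES (word σ)

/-- The descent set of the inverse. -/
def IDES {n : ℕ} (σ : Perm (Fin n)) : Finset ℕ := DES σ⁻¹

/-- The major index. -/
def maj {n : ℕ} (σ : Perm (Fin n)) : ℕ := ∑ i ∈ DES σ, i

/-- The inverse major index. -/
def imaj {n : ℕ} (σ : Perm (Fin n)) : ℕ := ∑ i ∈ IDES σ, i

/-- Reduction of the subword of `σ` formed by the letters in the positions `P`: with `m = #P`, the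
positions are numbered from `1` to `m` in increasing order and the letters `σ(j)`, `j ∈ P`, are
replaced by their images under the increasing bijection of `{σ(j) : j ∈ P}` onto `{1, …, m}`. -/
def reduce {n : ℕ} (σ : Perm (Fin n)) (P : Finset (Fin n)) : Perm (Fin P.card) :=
  ((P.orderIsoOfFin rfl).toEquiv.trans
    (σ.subtypeEquiv fun a => (by simp : a ∈ P ↔ σ a ∈ P.map σ.toEmbedding))).trans
    ((P.map σ.toEmbedding).orderIsoOfFin (Finset.card_map _)).symm.toEquiv

/-- `Der σ`: the reduction of the subword of the letters that are not fixed, a permutation in `S_m`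
where `m` is the number of non-fixed letters. -/
def Der {n : ℕ} (σ : Perm (Fin n)) : Σ m : ℕ, Perm (Fin m) :=
  ⟨_, reduce σ (Finset.univ.filter fun i => σ i ≠ i)⟩

/-- `ZDer σ`: each fixed point is replaced by `0`, each other letter `σ(i)` by its image under the
increasing bijection of the set of non-fixed points onto `{1, …, m}`. -/
def ZDer {n : ℕ} (σ : Perm (Fin n)) : List ℕ :=
  List.ofFn fun i =>
    if σ i = i then 0 else (Finset.univ.filter fun j => σ j ≠ j ∧ j ≤ σ i).card

/-- `maz σ = maj (ZDer σ)`. -/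
def maz {n : ℕ} (σ : Perm (Fin n)) : ℕ := wmaj (ZDer σ)

/-- `maf σ = ∑_{i ∈ FIX σ} i - ∑_{i=1}^{fix σ} i + maj (Der σ)` (the subtraction never
truncates). -/
def maf {n : ℕ} (σ : Perm (Fin n)) : ℕ :=
  (∑ i ∈ FIX σ, i - ∑ i ∈ Finset.Icc 1 (fix σ), i) + maj (Der σ).2

/-- A word `y_1 ⋯ y_n` without repetitions is a desarrangement if `y_1 > y_2 > ⋯ > y_{2k}` and
`y_{2k} < y_{2k+1}` for some `k ≥ 1`, where `y_{n+1} = ∞`. -/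
def IsDesarrWord (y : List ℕ) : Prop :=
  ∃ k ∈ Finset.Icc 1 y.length, 2 * k ≤ y.length ∧
    (∀ i ∈ Finset.Ico 1 (2 * k), y.getD i 0 < y.getD (i - 1) 0) ∧
    (2 * k < y.length → y.getD (2 * k - 1) 0 < y.getD (2 * k) 0)

instance : DecidablePred IsDesarrWord := fun y => by unfold IsDesarrWord; infer_instance

/-- The length of `σᵖ` in the pixed factorization `σ = σᵖ σᵈ`, where `σᵈ` is the longest right
factor of `σ` that is a desarrangement, and is empty if there is none. -/
def pixLength {n : ℕ} (σ : Perm (Fin n)) : ℕ :=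
  Nat.find (⟨n, Or.inr rfl⟩ : ∃ p, IsDesarrWord ((word σ).drop p) ∨ p = n)

/-- The set of the letters of `σᵖ`. -/
def PIX {n : ℕ} (σ : Perm (Fin n)) : Finset ℕ :=
  (Finset.univ.filter fun i : Fin n => (i : ℕ) < pixLength σ).image fun i : Fin n => (σ i : ℕ) + 1

/-- The number of the letters of `σᵖ`. -/
def pix {n : ℕ} (σ : Perm (Fin n)) : ℕ := (PIX σ).card

/-- `Desar σ`: the reduction of `σᵈ`, a permutation in `S_m` where `m` is the length of `σᵈ`. -/
def Desar {n : ℕ} (σ : Perm (Fin n)) : Σ m : ℕ, Perm (Fin m) :=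
  ⟨_, reduce σ (Finset.univ.filter fun i => pixLength σ ≤ i)⟩

/-- `mag σ = ∑_{i ∈ PIX σ} i - ∑_{i=1}^{pix σ} i + imaj (Desar σ)` (the subtraction never
truncates). -/
def mag {n : ℕ} (σ : Perm (Fin n)) : ℕ :=
  (∑ i ∈ PIX σ, i - ∑ i ∈ Finset.Icc 1 (pix σ), i) + imaj (Desar σ).2

/-- `ZDesar σ`: the shuffle of zeros and of the word of `(Desar σ)⁻¹` with zeros exactly in the
positions `PIX σ`. -/
def ZDesar {n : ℕ} (σ : Perm (Fin n)) : List ℕ :=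
  shuf n (PIX σ) (word (Desar σ).2⁻¹)

/-- The desarrangements of order `m`: the permutations without pixed points. -/
def desarrangements (m : ℕ) : Set (Perm (Fin m)) := {σ | PIX σ = ∅}

/-- The union of the shuffle classes of `0^{n-m}` and `v`, where `v` is a derangement of order
`m ≤ n`. -/
def SDer (n : ℕ) : Set (List ℕ) :=
  {w | ∃ m ≤ n, ∃ d ∈ derangements (Fin m), w ∈ Sh (n - m) (word d)}

/-- The union of the shuffle classes of `0^{n-m}` and `v`, where `v` is the inverse of a
desarrangement of order `m ≤ n`. -/
def SDesar (n : ℕ) : Set (List ℕ) :=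
  {w | ∃ m ≤ n, ∃ d ∈ desarrangements m, w ∈ Sh (n - m) (word d⁻¹)}

/-- Two statistics on `S_n` are equidistributed if each value is taken equally often. -/
def Equidistributed {n : ℕ} {α : Type*} (f g : Perm (Fin n) → α) : Prop :=
  ∀ a, Nat.card {σ // f σ = a} = Nat.card {σ // g σ = a}

/-! ### The bijections -/

/-- `F₃ = ZDer⁻¹ ∘ F₃ ∘ ZDer` on `S_n`. -/
noncomputable def F3 {n : ℕ} (σ : Perm (Fin n)) : Perm (Fin n) :=
  Function.invFun ZDer (F3w (ZDer σ))

/-- `F₃' = ZDesar⁻¹ ∘ F₃ ∘ ZDesar` on `S_n`. -/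
noncomputable def F3' {n : ℕ} (σ : Perm (Fin n)) : Perm (Fin n) :=
  Function.invFun ZDesar (F3w (ZDesar σ))

/-- `DW` is, in each order, a bijection of the derangements onto the desarrangements with
`IDES ∘ DW = DES`.  (Its values on permutations with fixed points are irrelevant.) -/
def IsDW (DW : ∀ m : ℕ, Perm (Fin m) → Perm (Fin m)) : Prop :=
  ∀ m, Set.BijOn (DW m) (derangements (Fin m)) (desarrangements m) ∧
    ∀ d ∈ derangements (Fin m), IDES (DW m d) = DES d

/-- `DW^loc τ` is the permutation `σ` with `(PIX σ, Desar σ) = (FIX τ, DW (Der τ))`. -/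
noncomputable def DWloc (DW : ∀ m : ℕ, Perm (Fin m) → Perm (Fin m)) {n : ℕ}
    (τ : Perm (Fin n)) : Perm (Fin n) :=
  Function.invFun (fun σ : Perm (Fin n) => (PIX σ, Desar σ)) (FIX τ, ⟨_, DW _ (Der τ).2⟩)

/-- `dw = ZDesar ∘ DW^loc ∘ ZDer⁻¹` on words of length `n`. -/
noncomputable def dw (DW : ∀ m : ℕ, Perm (Fin m) → Perm (Fin m)) (n : ℕ) (w : List ℕ) :
    List ℕ :=
  ZDesar (DWloc DW (Function.invFun (ZDer : Perm (Fin n) → List ℕ) w))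

end FixMah

/-!
A word is determined by its length, by the positions of its zeros and by its subword of positive
letters (`eq_of_Zero_eq_of_Pos_eq`), so every map below is understood through its effect on these.

*The transformation of words.* `F3w` keeps the positive letters, and it is injective because its
last letter and its positive letters reveal which branch the last step took; on a finite class that
it preserves it is therefore a bijection. That `mafz (F3w w) = wmaj w` is an induction on the last
letter: a rotation adds the number of zeros to `mafz`, and takes away the length when the word ends
with a zero (`mafz_rot`), an appended zero adds the number of positive letters, and together these
are the change of the major index.

*The two decompositions.* Both encode a permutation of order `n` by a permutation `d` of order `m`
and an increasing embedding `ι` of `Fin m` in `Fin n`; the word `ZDer σ` or `ZDesar σ` is then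
`shuffleWord d ι`. For the fixed decomposition this is immediate. For the pixed one, whether a right
factor is a desarrangement alternates along the descents, from right to left (`isDesarrWord_cons`),
hence the left factor is increasing, and conversely an increasing left factor followed by a
desarrangement, or by nothing, is the pixed factorization (`pixLength_eq_iff`). The descents of
`ZDesar σ` are those of `σ⁻¹` (`wDES_ZDesar`).

*Existence of `DW`.* For a monotone `b`, count the permutations that are increasing on each fibre of
`b`. Under either decomposition (applied to the inverse permutation in the pixed case) such a
permutation is a `d` in the class considered, increasing on the fibres of `b ∘ ι`, with
the remaining elements in a forced place of each fibre; so the number of permutations is the sum,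
over the functions of the form `b ∘ ι`, of the numbers of such `d`. Both classes satisfy this same
recurrence, hence the numbers agree (`DecompSystem.card_incOn_eq`). Choosing `b` constant
except for jumps at `J` gives equally many derangements and inverses of desarrangements with
descent set contained in `J`, hence with descent set equal to `J`.

*The diagram.* The zeros of `F3w w` depend only on the zeros of `w` and on the descents of its
positive subword (`Zero_F3w_congr`), and `DW` preserves these descents; this is why `F3w` commutes
with `dw`.
-/

open Equiv

namespace FixMah

/-! ### Words: zeros, positive letters, descents -/

theorem mem_Zero {w : List ℕ} {i : ℕ} :
    i ∈ Zero w ↔ 1 ≤ i ∧ i ≤ w.length ∧ w.getD (i - 1) 0 = 0 := by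
  simp [Zero, and_assoc]

theorem mem_wDES {w : List ℕ} {i : ℕ} :
    i ∈ wDES w ↔ 1 ≤ i ∧ i < w.length ∧ w.getD i 0 < w.getD (i - 1) 0 := by
  simp only [wDES, Finset.mem_filter, Finset.mem_Icc]
  constructor
  · rintro ⟨⟨h1, h2⟩, h3⟩; exact ⟨h1, by omega, h3⟩
  · rintro ⟨h1, h2, h3⟩; exact ⟨⟨h1, by omega⟩, h3⟩

theorem Zero_subset (w : List ℕ) : Zero w ⊆ Finset.Icc 1 w.length := Finset.filter_subset _ _

theorem Zero_append_singleton (w : List ℕ) (x : ℕ) :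
    Zero (w ++ [x]) = if x = 0 then insert (w.length + 1) (Zero w) else Zero w := by
  ext i
  have key : i ∈ Zero (w ++ [x]) ↔ i ∈ Zero w ∨ (i = w.length + 1 ∧ x = 0) := by
    simp only [mem_Zero, List.length_append, List.length_singleton]
    rcases lt_trichotomy i (w.length + 1) with h | h | h
    · by_cases h0 : 1 ≤ i
      · rw [List.getD_append _ _ _ _ (by omega)]; omega
      · omega
    · subst h; simp
    · omega
  rw [key]; split_ifs with hx <;> simp [hx, or_comm]

theorem Pos_append_singleton (w : List ℕ) (x : ℕ) :
    Pos (w ++ [x]) = if x = 0 then Pos w else Pos w ++ [x] := by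
  unfold Pos; rw [List.filter_append]; split_ifs with h <;> simp [h, Nat.pos_iff_ne_zero]

theorem pos_of_mem_Pos {w : List ℕ} {x : ℕ} (h : x ∈ Pos w) : 0 < x := by
  simpa using (List.mem_filter.1 h).2

theorem notMem_Zero_of_length_lt {w : List ℕ} {i : ℕ} (h : w.length < i) : i ∉ Zero w :=
  fun hi => by have := (mem_Zero.1 hi).2.1; omega

theorem card_Zero_add_length_Pos (w : List ℕ) : (Zero w).card + (Pos w).length = w.length := by
  induction w using List.reverseRecOn with
  | nil => rfl
  | append_singleton w x ih =>
    rw [Zero_append_singleton, Pos_append_singleton]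
    split_ifs with h
    · rw [Finset.card_insert_of_notMem (notMem_Zero_of_length_lt (by omega))]; simp; omega
    · simp; omega

theorem wDES_append_singleton (w : List ℕ) (x : ℕ) :
    wDES (w ++ [x]) = if x < w.getLastD 0 then insert w.length (wDES w) else wDES w := by
  ext i
  have key : i ∈ wDES (w ++ [x]) ↔ i ∈ wDES w ∨ (i = w.length ∧ x < w.getLastD 0) := by
    simp only [mem_wDES, List.length_append, List.length_singleton]
    rcases lt_trichotomy i w.length with h | h | h
    · by_cases h0 : 1 ≤ i
      · rw [List.getD_append _ _ _ _ (by omega), List.getD_append _ _ _ _ (by omega)]; omega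
      · omega
    · subst h
      rcases List.eq_nil_or_concat w with rfl | ⟨u, y, rfl⟩
      · simp
      · simp
    · omega
  rw [key]; split_ifs with hx
  · rw [Finset.mem_insert]; tauto
  · tauto

theorem notMem_wDES_of_length_le {w : List ℕ} {i : ℕ} (h : w.length ≤ i) : i ∉ wDES w :=
  fun hi => by have := (mem_wDES.1 hi).2.1; omega

theorem wmaj_append_singleton (w : List ℕ) (x : ℕ) :
    wmaj (w ++ [x]) = wmaj w + if x < w.getLastD 0 then w.length else 0 := by
  unfold wmaj
  rw [wDES_append_singleton]
  split_ifs with h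
  · rw [Finset.sum_insert (notMem_wDES_of_length_le le_rfl), add_comm]
  · rfl

theorem shuf_Zero_Pos (w : List ℕ) : shuf w.length (Zero w) (Pos w) = w := by
  induction w using List.reverseRecOn with
  | nil => rfl
  | append_singleton w x ih =>
    have hcard : ((Finset.Icc 1 w.length).filter fun j => j ∉ Zero (w ++ [x])).card
        = (Pos w).length := by
      have h1 := card_Zero_add_length_Pos w
      have h2 : (Finset.Icc 1 w.length).filter (fun j => j ∉ Zero (w ++ [x]))
          = Finset.Icc 1 w.length \ Zero w := by
        ext j
        have : j ≤ w.length → (j ∈ Zero (w ++ [x]) ↔ j ∈ Zero w) := by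
          intro hj; rw [Zero_append_singleton]; split_ifs
          · simp; omega
          · rfl
        simp only [Finset.mem_filter, Finset.mem_sdiff, Finset.mem_Icc]
        constructor <;> rintro ⟨⟨a, b⟩, c⟩ <;> exact ⟨⟨a, b⟩, by simpa [this b] using c⟩
      rw [h2, Finset.card_sdiff_of_subset (Zero_subset w)]; simp; omega
    conv_rhs => rw [← ih]
    unfold shuf
    rw [List.length_append, List.length_singleton, List.range'_1_concat, List.map_append]
    congr 1
    · apply List.map_congr_left
      intro i hi
      rw [List.mem_range'_1] at hi
      have hm : i ∈ Zero (w ++ [x]) ↔ i ∈ Zero w := by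
        rw [Zero_append_singleton]; split_ifs
        · simp; omega
        · rfl
      rw [if_congr hm rfl rfl]
      split_ifs with h
      · rfl
      · have hsub : (Finset.Icc 1 (i - 1)).filter (fun j => j ∉ Zero (w ++ [x]))
            = (Finset.Icc 1 (i - 1)).filter (fun j => j ∉ Zero w) := by
          apply Finset.filter_congr
          intro j hj
          rw [Finset.mem_Icc] at hj
          rw [Zero_append_singleton]; split_ifs
          · simp; omega
          · rfl
        have hlt : ((Finset.Icc 1 (i - 1)).filter fun j => j ∉ Zero w).card
            < (Pos w).length := by
          rw [← hcard, ← hsub]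
          apply Finset.card_lt_card
          rw [Finset.ssubset_iff_of_subset
            (Finset.filter_subset_filter _ (Finset.Icc_subset_Icc le_rfl (by omega)))]
          exact ⟨i, by simp [hm, h]; omega, by simp; omega⟩
        rw [hsub, Pos_append_singleton]
        split_ifs
        · rfl
        · rw [List.getD_append _ _ _ _ hlt]
    · rw [List.map_singleton]
      congr 1
      rw [show 1 + w.length - 1 = w.length by omega, hcard, Zero_append_singleton,
        Pos_append_singleton]
      by_cases hx : x = 0
      · simp [hx, add_comm]
      · have := notMem_Zero_of_length_lt (w := w) (i := 1 + w.length) (by omega)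
        simp [hx, this]

/-- A word is determined by its length, the positions of its zeros and its positive letters. -/
theorem eq_of_Zero_eq_of_Pos_eq {w w' : List ℕ} (hl : w.length = w'.length)
    (hZ : Zero w = Zero w') (hP : Pos w = Pos w') : w = w' := by
  rw [← shuf_Zero_Pos w, ← shuf_Zero_Pos w', hl, hZ, hP]

theorem exists_Zero_eq_Pos_eq (n : ℕ) (Z : Finset ℕ) (v : List ℕ) (hZ : Z ⊆ Finset.Icc 1 n)
    (hv : ∀ x ∈ v, 0 < x) (hn : Z.card + v.length = n) :
    ∃ w : List ℕ, w.length = n ∧ Zero w = Z ∧ Pos w = v := by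
  induction n generalizing Z v with
  | zero =>
    have h1 : Z = ∅ := Finset.card_eq_zero.1 (by omega)
    have h2 : v = [] := List.length_eq_zero_iff.1 (by omega)
    exact ⟨[], rfl, by rw [h1]; rfl, by rw [h2]; rfl⟩
  | succ n ih =>
    by_cases h : n + 1 ∈ Z
    · obtain ⟨w, h1, h2, h3⟩ := ih (Z.erase (n + 1)) v (by
        intro i hi
        have := hZ (Finset.mem_of_mem_erase hi)
        have := Finset.ne_of_mem_erase hi
        simp only [Finset.mem_Icc] at *; omega) hv (by
        have := Finset.card_erase_add_one h; omega)
      refine ⟨w ++ [0], by simp [h1], ?_, ?_⟩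
      · rw [Zero_append_singleton, if_pos rfl, h1, h2, Finset.insert_erase h]
      · rw [Pos_append_singleton, if_pos rfl, h3]
    · have hZ' : Z ⊆ Finset.Icc 1 n := by
        intro i hi
        have := hZ hi
        have : i ≠ n + 1 := fun e => h (e ▸ hi)
        simp only [Finset.mem_Icc] at *; omega
      rcases List.eq_nil_or_concat v with rfl | ⟨v, x, rfl⟩
      · have := Finset.card_le_card hZ'
        simp at this hn; omega
      · rw [List.concat_eq_append] at *
        have hx : x ≠ 0 := (hv x (by simp)).ne'
        obtain ⟨w, h1, h2, h3⟩ := ih Z v hZ' (fun y hy => hv y (by simp [hy]))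
          (by simp at hn; omega)
        refine ⟨w ++ [x], by simp [h1], ?_, ?_⟩
        · rw [Zero_append_singleton, if_neg hx, h2]
        · rw [Pos_append_singleton, if_neg hx, h3]

theorem shuf_spec {n : ℕ} {Z : Finset ℕ} {v : List ℕ} (hZ : Z ⊆ Finset.Icc 1 n)
    (hv : ∀ x ∈ v, 0 < x) (hn : Z.card + v.length = n) :
    (shuf n Z v).length = n ∧ Zero (shuf n Z v) = Z ∧ Pos (shuf n Z v) = v := by
  obtain ⟨w, rfl, rfl, rfl⟩ := exists_Zero_eq_Pos_eq n Z v hZ hv hn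
  rw [shuf_Zero_Pos]; exact ⟨rfl, rfl, rfl⟩

theorem mem_Sh_iff {k : ℕ} {v w : List ℕ} (hv : ∀ x ∈ v, 0 < x) :
    w ∈ Sh k v ↔ w.length = k + v.length ∧ Pos w = v := by
  constructor
  · rintro ⟨h1, h2⟩; exact ⟨by simpa using h1.length_eq, h2⟩
  · rintro ⟨h1, rfl⟩
    refine ⟨?_, rfl⟩
    have h := List.filter_append_perm (fun x => decide (0 < x)) w
    have hrep : w.filter (fun x => !decide (0 < x)) = List.replicate k 0 := by
      rw [List.eq_replicate_iff]
      constructor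
      · have := h.length_eq
        rw [List.length_append] at this
        have e : (Pos w).length = (w.filter (fun x => decide (0 < x))).length := rfl
        omega
      · intro x hx; simpa using (List.mem_filter.1 hx).2
    rw [hrep] at h
    exact h.symm.trans List.perm_append_comm

/-! ### Rotations of the zeros and the transformation `F3w` -/

theorem rot_spec (u : List ℕ) :
    (rot u).length = u.length ∧
      Zero (rot u) = (Zero u).image (fun i => if i = u.length then 1 else i + 1) ∧
      Pos (rot u) = Pos u := by
  apply shuf_spec
  · intro i hi
    obtain ⟨j, hj, rfl⟩ := Finset.mem_image.1 hi
    have := Finset.mem_Icc.1 (Zero_subset u hj)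
    rw [Finset.mem_Icc]
    split_ifs <;> omega
  · intro x hx; exact pos_of_mem_Pos hx
  · rw [Finset.card_image_of_injOn, card_Zero_add_length_Pos]
    intro i hi j hj h
    have hi := Finset.mem_Icc.1 (Zero_subset u hi)
    have hj := Finset.mem_Icc.1 (Zero_subset u hj)
    dsimp only at h
    split_ifs at h <;> omega

theorem length_rot (u : List ℕ) : (rot u).length = u.length := (rot_spec u).1
theorem Zero_rot (u : List ℕ) :
    Zero (rot u) = (Zero u).image fun i => if i = u.length then 1 else i + 1 := (rot_spec u).2.1
theorem Pos_rot (u : List ℕ) : Pos (rot u) = Pos u := (rot_spec u).2.2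

theorem injOn_cyclicShift (n : ℕ) :
    Set.InjOn (fun i => if i = n then 1 else i + 1) (Finset.Icc 1 n : Set ℕ) := by
  intro i hi j hj h
  rw [Finset.mem_coe, Finset.mem_Icc] at hi hj
  dsimp only at h
  split_ifs at h <;> omega

theorem rot_injective : Function.Injective rot := by
  intro u u' h
  have hl : u.length = u'.length := by rw [← length_rot u, ← length_rot u', h]
  refine eq_of_Zero_eq_of_Pos_eq hl ?_ (by rw [← Pos_rot u, ← Pos_rot u', h])
  have hZ : Zero (rot u) = Zero (rot u') := by rw [h]
  rw [Zero_rot, Zero_rot, ← hl] at hZ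
  refine Finset.coe_injective ((injOn_cyclicShift u.length).image_eq_image_iff
    (Finset.coe_subset.2 (Zero_subset u)) (Finset.coe_subset.2 (hl ▸ Zero_subset u')) |>.1 ?_)
  exact_mod_cast congrArg (fun s : Finset ℕ => (s : Set ℕ)) hZ

theorem F3w_append_singleton (w : List ℕ) (x : ℕ) : F3w (w ++ [x]) = F3step (F3w w) x := by
  simp [F3w, List.foldl_append]

theorem length_F3w (w : List ℕ) : (F3w w).length = w.length := by
  induction w using List.reverseRecOn with
  | nil => rfl
  | append_singleton w x ih =>
    rw [F3w_append_singleton, F3step]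
    split_ifs <;> simp [length_rot, ih]

theorem Pos_F3w (w : List ℕ) : Pos (F3w w) = Pos w := by
  induction w using List.reverseRecOn with
  | nil => rfl
  | append_singleton w x ih =>
    rw [F3w_append_singleton, F3step, Pos_append_singleton, Pos_append_singleton]
    split_ifs <;> simp_all [Pos_rot]

theorem getLastD_F3w (w : List ℕ) : (F3w w).getLastD 0 = w.getLastD 0 := by
  rcases List.eq_nil_or_concat w with rfl | ⟨w, x, rfl⟩
  · rfl
  · rw [List.concat_eq_append, F3w_append_singleton, F3step]; simp

/-- The last letter and the positive letters are not changed by `F3w`, so its value reveals whether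
the last step began with a rotation. -/
theorem F3w_injective : Function.Injective F3w := by
  intro w
  induction w using List.reverseRecOn with
  | nil =>
    intro w' h
    have := congrArg List.length h
    rw [length_F3w, length_F3w] at this
    exact (List.length_eq_zero_iff.1 this.symm).symm
  | append_singleton w x ih =>
    intro w' h
    have hP : Pos (w ++ [x]) = Pos w' := by rw [← Pos_F3w, h, Pos_F3w]
    rcases List.eq_nil_or_concat w' with rfl | ⟨w', x', rfl⟩
    · have := congrArg List.length h
      rw [length_F3w, length_F3w] at this
      simp at this
    rw [List.concat_eq_append] at *
    rw [F3w_append_singleton, F3w_append_singleton, F3step, F3step] at h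
    obtain ⟨h1, h2⟩ := List.append_inj' h rfl
    obtain rfl : x = x' := by simpa using h2
    have hP' : Pos w = Pos w' := by
      rw [Pos_append_singleton, Pos_append_singleton] at hP
      split_ifs at hP with hx
      · exact hP
      · exact List.append_cancel_right hP
    rw [Pos_F3w, Pos_F3w, hP'] at h1
    split_ifs at h1
    · rw [ih (rot_injective h1)]
    · rw [ih h1]

theorem sum_Icc_card_le_sum_Zero (w : List ℕ) :
    ∑ i ∈ Finset.Icc 1 (Zero w).card, i ≤ ∑ i ∈ Zero w, i := by
  induction w using List.reverseRecOn with
  | nil => rfl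
  | append_singleton w x ih =>
    rw [Zero_append_singleton]
    split_ifs
    · have h := notMem_Zero_of_length_lt (w := w) (Nat.lt_succ_self _)
      have := card_Zero_add_length_Pos w
      rw [Finset.card_insert_of_notMem h, Finset.sum_insert h,
        Finset.sum_Icc_succ_top (by omega)]
      omega
    · exact ih

theorem mafz_add (w : List ℕ) :
    mafz w + ∑ i ∈ Finset.Icc 1 (Zero w).card, i = ∑ i ∈ Zero w, i + wmaj (Pos w) := by
  have := sum_Icc_card_le_sum_Zero w
  unfold mafz; omega

theorem mafz_append_zero (w : List ℕ) : mafz (w ++ [0]) = mafz w + (Pos w).length := by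
  have h1 := mafz_add (w ++ [0])
  have h2 := mafz_add w
  have h := notMem_Zero_of_length_lt (w := w) (Nat.lt_succ_self _)
  have := card_Zero_add_length_Pos w
  rw [Zero_append_singleton, if_pos rfl, Finset.card_insert_of_notMem h, Finset.sum_insert h,
    Finset.sum_Icc_succ_top (by omega), Pos_append_singleton, if_pos rfl] at h1
  omega

theorem mafz_append_of_ne_zero (w : List ℕ) {x : ℕ} (hx : x ≠ 0) :
    mafz (w ++ [x]) = mafz w + if x < (Pos w).getLastD 0 then (Pos w).length else 0 := by
  unfold mafz
  rw [Zero_append_singleton, if_neg hx, Pos_append_singleton, if_neg hx, wmaj_append_singleton]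
  omega

/-- A rotation raises `mafz` by the number of zeros, and lowers it by the length of the word when
the zero in the last position comes back to the first one. -/
theorem mafz_rot (u : List ℕ) (hu : u ≠ []) :
    mafz (rot u) + (if u.getLastD 0 = 0 then u.length else 0) = mafz u + (Zero u).card := by
  have h1 := mafz_add (rot u)
  have h2 := mafz_add u
  have hinj := (injOn_cyclicShift u.length).mono (Finset.coe_subset.2 (Zero_subset u))
  have hl : u.length ∈ Zero u ↔ u.getLastD 0 = 0 := by
    rcases List.eq_nil_or_concat u with rfl | ⟨u, x, rfl⟩
    · exact absurd rfl hu
    · rw [List.concat_eq_append, mem_Zero]; simp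
  rw [Zero_rot, Pos_rot, Finset.card_image_of_injOn hinj, Finset.sum_image hinj] at h1
  have h3 : ∑ i ∈ Zero u, (if i = u.length then 1 else i + 1)
      + (if u.getLastD 0 = 0 then u.length else 0) = ∑ i ∈ Zero u, i + (Zero u).card := by
    rw [← if_congr hl rfl rfl, ← Finset.sum_ite_eq' (Zero u) u.length (fun i => i),
      ← Finset.sum_add_distrib, Finset.card_eq_sum_ones, ← Finset.sum_add_distrib]
    apply Finset.sum_congr rfl
    intro i _
    split_ifs <;> omega
  omega

theorem getLastD_Pos {w : List ℕ} (h : w.getLastD 0 ≠ 0) :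
    (Pos w).getLastD 0 = w.getLastD 0 := by
  rcases List.eq_nil_or_concat w with rfl | ⟨w, x, rfl⟩
  · rfl
  · rw [List.concat_eq_append] at *
    have hx : x ≠ 0 := by simpa using h
    rw [Pos_append_singleton, if_neg hx]; simp

theorem mafz_F3w (w : List ℕ) : mafz (F3w w) = wmaj w := by
  induction w using List.reverseRecOn with
  | nil => rfl
  | append_singleton w x ih =>
    by_cases hw : w = []
    · subst hw
      have : rot [] = [] := List.length_eq_zero_iff.1 (length_rot [])
      by_cases hx : x = 0
      · subst hx; rfl
      · rw [F3w_append_singleton, wmaj_append_singleton]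
        simp [F3step, F3w, hx, Pos]
        simpa [mafz, Zero, Pos, wmaj, wDES] using mafz_append_of_ne_zero [] hx
    have hw' : F3w w ≠ [] := by
      intro h; apply hw; rw [← List.length_eq_zero_iff, ← length_F3w, h]; rfl
    have hr := mafz_rot _ hw'
    have hc := card_Zero_add_length_Pos (F3w w)
    rw [getLastD_F3w, length_F3w] at hr
    rw [length_F3w] at hc
    rw [F3w_append_singleton, wmaj_append_singleton, ← ih, F3step]
    by_cases hx : x = 0
    · subst hx
      rw [if_pos (Or.inl rfl), mafz_append_zero, Pos_rot]
      by_cases h0 : w.getLastD 0 = 0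
      · rw [if_pos h0] at hr; rw [h0, if_neg (lt_irrefl 0)]; omega
      · rw [if_neg h0] at hr; rw [if_pos (Nat.pos_of_ne_zero h0)]; omega
    · rw [mafz_append_of_ne_zero _ hx]
      by_cases hlt : x < (Pos (F3w w)).getLastD 0
      · rw [if_pos (Or.inr hlt), Pos_rot, if_pos hlt]
        by_cases h0 : w.getLastD 0 = 0
        · rw [if_pos h0] at hr; rw [h0, if_neg (Nat.not_lt_zero x)]; omega
        · rw [if_neg h0] at hr
          rw [Pos_F3w, getLastD_Pos h0] at hlt
          rw [if_pos hlt]; omega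
      · rw [if_neg (by tauto), if_neg hlt]
        congr 1
        rw [Pos_F3w] at hlt
        by_cases h0 : w.getLastD 0 = 0
        · rw [h0, if_neg (Nat.not_lt_zero x)]
        · rw [getLastD_Pos h0] at hlt
          rw [if_neg hlt]

theorem bijOn_F3w_of_finite {S : Set (List ℕ)} (hS : S.Finite) (h : Set.MapsTo F3w S S) :
    Set.BijOn F3w S S :=
  (hS.injOn_iff_bijOn_of_mapsTo h).1 F3w_injective.injOn

theorem finite_Sh (k : ℕ) (v : List ℕ) : (Sh k v).Finite :=
  (List.finite_toSet (List.replicate k 0 ++ v).permutations).subset fun w hw =>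
    show w ∈ (List.replicate k 0 ++ v).permutations from List.mem_permutations.2 hw.1

theorem mapsTo_F3w_Sh {k : ℕ} {v : List ℕ} (hv : ∀ x ∈ v, 0 < x) :
    Set.MapsTo F3w (Sh k v) (Sh k v) := by
  intro w hw
  rw [mem_Sh_iff hv] at *
  rwa [length_F3w, Pos_F3w]

/-- The positions of the zeros of `F3w w` depend only on the positions of the zeros of `w` and on
the descents of `Pos w`. -/
theorem Zero_F3w_congr {w w' : List ℕ} (hl : w.length = w'.length) (hZ : Zero w = Zero w')
    (hD : wDES (Pos w) = wDES (Pos w')) : Zero (F3w w) = Zero (F3w w') := by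
  induction w using List.reverseRecOn generalizing w' with
  | nil => rw [List.length_eq_zero_iff.1 hl.symm]
  | append_singleton w x ih =>
    rcases List.eq_nil_or_concat w' with rfl | ⟨w', x', rfl⟩
    · simp at hl
    rw [List.concat_eq_append] at *
    have hl' : w.length = w'.length := by simpa using hl
    have hn := notMem_Zero_of_length_lt (w := w) (Nat.lt_succ_self _)
    have hn' := notMem_Zero_of_length_lt (w := w') (Nat.lt_succ_self _)
    have hx : x = 0 ↔ x' = 0 := by
      rw [Zero_append_singleton, Zero_append_singleton, hl'] at hZ
      rw [hl'] at hn
      split_ifs at hZ with h h' h'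
      · simp [h, h']
      · exact absurd (hZ ▸ Finset.mem_insert_self _ _) hn'
      · exact absurd (hZ ▸ Finset.mem_insert_self _ _) hn
      · simp [h, h']
    have hZ' : Zero w = Zero w' := by
      rw [Zero_append_singleton, Zero_append_singleton, hl', if_congr hx rfl rfl] at hZ
      split_ifs at hZ
      · rw [← Finset.erase_insert hn, ← Finset.erase_insert hn', ← hZ, hl']
      · exact hZ
    have hPl : (Pos w).length = (Pos w').length := by
      have h1 := card_Zero_add_length_Pos w
      have h2 := card_Zero_add_length_Pos w'
      rw [hZ'] at h1; omega
    have hm := notMem_wDES_of_length_le (w := Pos w) le_rfl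
    have hm' := notMem_wDES_of_length_le (w := Pos w') le_rfl
    have hD' : wDES (Pos w) = wDES (Pos w') ∧
        ((x = 0 ∨ x < (Pos w).getLastD 0) ↔ (x' = 0 ∨ x' < (Pos w').getLastD 0)) := by
      rw [Pos_append_singleton, Pos_append_singleton, if_congr hx rfl rfl] at hD
      rw [hPl] at hm
      by_cases h : x' = 0
      · rw [if_pos h, if_pos h] at hD; simp [hx, h, hD]
      · rw [if_neg h, if_neg h, wDES_append_singleton, wDES_append_singleton, hPl] at hD
        rw [hx]; simp only [h, false_or]
        split_ifs at hD with h1 h2 h2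
        · refine ⟨?_, by simp only [h1, h2]⟩
          rw [← Finset.erase_insert hm, ← Finset.erase_insert hm', ← hD]
        · exact absurd (hD ▸ Finset.mem_insert_self _ _) hm'
        · exact absurd (hD ▸ Finset.mem_insert_self _ _) hm
        · exact ⟨hD, by simp only [h1, h2]⟩
    have key := ih hl' hZ' hD'.1
    rw [F3w_append_singleton, F3w_append_singleton, F3step, F3step, Zero_append_singleton,
      Zero_append_singleton, if_congr hx rfl rfl, Pos_F3w, Pos_F3w, if_congr hD'.2 rfl rfl]
    have e : (if x' = 0 ∨ x' < (Pos w').getLastD 0 then rot (F3w w) else F3w w).length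
        = (if x' = 0 ∨ x' < (Pos w').getLastD 0 then rot (F3w w') else F3w w').length := by
      split_ifs <;> simp [length_rot, length_F3w, hl']
    have e' : Zero (if x' = 0 ∨ x' < (Pos w').getLastD 0 then rot (F3w w) else F3w w)
        = Zero (if x' = 0 ∨ x' < (Pos w').getLastD 0 then rot (F3w w') else F3w w') := by
      split_ifs
      · rw [Zero_rot, Zero_rot, key, length_F3w, length_F3w, hl']
      · exact key
    rw [e, e']

/-! ### Shuffles of zeros and of the word of a permutation -/

theorem getD_ofFn {n : ℕ} (f : Fin n → ℕ) (i : Fin n) : (List.ofFn f).getD i 0 = f i := by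
  rw [List.getD_eq_getElem _ _ (by simp)]; simp

theorem mem_image_val_succ {n : ℕ} (p : Fin n → Prop) [DecidablePred p] {i : ℕ} :
    i ∈ (Finset.univ.filter p).image (fun i : Fin n => (i : ℕ) + 1) ↔
      ∃ a : Fin n, p a ∧ (a : ℕ) + 1 = i := by simp

theorem Zero_ofFn {n : ℕ} (f : Fin n → ℕ) :
    Zero (List.ofFn f)
      = (Finset.univ.filter fun i => f i = 0).image fun i : Fin n => (i : ℕ) + 1 := by
  ext i
  rw [mem_Zero, mem_image_val_succ, List.length_ofFn]
  constructor
  · rintro ⟨h1, h2, h3⟩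
    refine ⟨⟨i - 1, by omega⟩, ?_, by simp; omega⟩
    rw [← getD_ofFn f]; exact h3
  · rintro ⟨a, h, rfl⟩
    exact ⟨by omega, a.2, by rw [Nat.add_sub_cancel, getD_ofFn]; exact h⟩

theorem Pos_ofFn {m n : ℕ} (f : Fin n → ℕ) (ι : Fin m ↪o Fin n)
    (h : ∀ i, 0 < f i ↔ i ∈ Set.range ι) : Pos (List.ofFn f) = List.ofFn (f ∘ ι) := by
  rw [List.ofFn_eq_map, List.ofFn_eq_map, Pos, List.filter_map, ← List.map_map]
  congr 1
  have hn : (List.finRange n).SortedLT := List.sortedLT_finRange n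
  have hm : (List.finRange m).SortedLT := List.sortedLT_finRange m
  refine List.SortedLT.eq_of_mem_iff ?_ ?_ ?_
  · exact (hn.pairwise.filter _).sortedLT
  · exact (List.Pairwise.map _ (fun a b hab => ι.strictMono hab) hm.pairwise).sortedLT
  · intro i; simp [h]

theorem length_word {m : ℕ} (d : Perm (Fin m)) : (word d).length = m := List.length_ofFn

theorem pos_of_mem_word {m : ℕ} {d : Perm (Fin m)} {x : ℕ} (h : x ∈ word d) : 0 < x := by
  obtain ⟨i, rfl⟩ := (List.mem_ofFn' _ _).1 h; exact Nat.succ_pos _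

/-- A word determines the permutation, including its order. -/
theorem sigma_eq_of_word_eq {m m' : ℕ} {d : Perm (Fin m)} {d' : Perm (Fin m')}
    (h : word d = word d') : (⟨m, d⟩ : Σ m : ℕ, Perm (Fin m)) = ⟨m', d'⟩ := by
  obtain rfl : m = m' := by rw [← length_word d, h, length_word]
  congr 1
  ext i
  have := congrFun (List.ofFn_injective h) i
  simpa using this

/-- The data that determine a permutation in the fixed and in the pixed decomposition: a
permutation of order `m`, and the places in `Fin n` of its letters. -/
abbrev Decomp (n : ℕ) := Σ m : ℕ, Perm (Fin m) × (Fin m ↪o Fin n)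

/-- The shuffle of zeros and of the word of `d`, with the letters of `d` in the positions
`ι 0 < ι 1 < ⋯`. -/
noncomputable def shuffleWord {m n : ℕ} (d : Perm (Fin m)) (ι : Fin m ↪o Fin n) : List ℕ :=
  List.ofFn (Function.extend ι (fun j => (d j : ℕ) + 1) 0)

theorem extend_pos_iff {m n : ℕ} (d : Perm (Fin m)) (ι : Fin m ↪o Fin n) (i : Fin n) :
    0 < Function.extend ι (fun j => (d j : ℕ) + 1) 0 i ↔ i ∈ Set.range ι := by
  by_cases h : i ∈ Set.range ι
  · obtain ⟨j, rfl⟩ := h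
    rw [ι.injective.extend_apply]; simp
  · rw [Function.extend_apply' _ _ _ h]; simpa using h

theorem length_shuffleWord {m n : ℕ} (d : Perm (Fin m)) (ι : Fin m ↪o Fin n) :
    (shuffleWord d ι).length = n := List.length_ofFn

open Classical in
theorem Zero_shuffleWord {m n : ℕ} (d : Perm (Fin m)) (ι : Fin m ↪o Fin n) :
    Zero (shuffleWord d ι)
      = (Finset.univ.filter fun i => i ∉ Set.range ι).image fun i : Fin n => (i : ℕ) + 1 := by
  rw [shuffleWord, Zero_ofFn]
  congr 1
  apply Finset.filter_congr
  intro i _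
  rw [← extend_pos_iff d ι, Nat.pos_iff_ne_zero, not_not]

theorem Pos_shuffleWord {m n : ℕ} (d : Perm (Fin m)) (ι : Fin m ↪o Fin n) :
    Pos (shuffleWord d ι) = word d := by
  rw [shuffleWord, Pos_ofFn _ ι (extend_pos_iff d ι), word]
  congr 1; funext j
  simp [ι.injective.extend_apply]

theorem sigma_eq_of_range_eq {m m' n : ℕ} {ι : Fin m ↪o Fin n} {ι' : Fin m' ↪o Fin n}
    (hι : Set.range ι = Set.range ι') : (⟨m, ι⟩ : Σ m : ℕ, Fin m ↪o Fin n) = ⟨m', ι'⟩ := by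
  obtain rfl : m = m' := by
    have := congrArg Set.ncard hι
    rwa [← Set.image_univ, ← Set.image_univ, Set.ncard_image_of_injective _ ι.injective,
      Set.ncard_image_of_injective _ ι'.injective, Set.ncard_univ, Set.ncard_univ,
      Nat.card_fin, Nat.card_fin] at this
  obtain rfl : ι = ι' :=
    DFunLike.coe_injective ((StrictMono.range_inj ι.strictMono ι'.strictMono).1 hι)
  rfl

theorem shuffleWord_injective {n : ℕ} :
    Function.Injective fun D : Decomp n => shuffleWord D.2.1 D.2.2 := by
  classical
  rintro ⟨m, d, ι⟩ ⟨m', d', ι'⟩ h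
  dsimp only at h
  have hw : (⟨m, d⟩ : Σ m : ℕ, Perm (Fin m)) = ⟨m', d'⟩ :=
    sigma_eq_of_word_eq (by rw [← Pos_shuffleWord d ι, h, Pos_shuffleWord])
  have hZ := Zero_shuffleWord d ι
  rw [h, Zero_shuffleWord d' ι'] at hZ
  have hι : Set.range ι = Set.range ι' := by
    ext i
    have h1 := congrArg (fun s => (i : ℕ) + 1 ∈ s) hZ
    simp only [mem_image_val_succ, add_left_inj, ← Fin.ext_iff, exists_eq_right] at h1
    rw [eq_iff_iff, not_iff_not] at h1
    exact h1.symm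
  cases sigma_eq_of_range_eq hι
  obtain rfl := eq_of_heq (Sigma.mk.inj hw).2
  rfl

theorem exists_eq_shuffleWord {m n : ℕ} {d : Perm (Fin m)} {w : List ℕ} (hl : w.length = n)
    (hP : Pos w = word d) : ∃ ι : Fin m ↪o Fin n, w = shuffleWord d ι := by
  classical
  have hZ := Zero_subset w
  have hc := card_Zero_add_length_Pos w
  rw [hP, length_word] at hc
  let P : Finset (Fin n) := Finset.univ.filter fun i => (i : ℕ) + 1 ∉ Zero w
  have hPc : P.card = m := by
    have h1 : Pᶜ.image (fun i : Fin n => (i : ℕ) + 1) = Zero w := by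
      ext i
      simp only [P, Finset.compl_filter, not_not, mem_image_val_succ]
      constructor
      · rintro ⟨a, h, rfl⟩; exact h
      · intro h
        have := Finset.mem_Icc.1 (hZ h)
        exact ⟨⟨i - 1, by omega⟩, by simpa [Nat.sub_add_cancel this.1] using h,
          by simp; omega⟩
    have h2 := congrArg Finset.card h1
    rw [Finset.card_image_of_injective _ (fun a b h => by simpa [Fin.ext_iff] using h),
      Finset.card_compl, Fintype.card_fin] at h2
    have := P.card_le_univ
    rw [Fintype.card_fin] at this
    omega
  refine ⟨P.orderEmbOfFin hPc, eq_of_Zero_eq_of_Pos_eq ?_ ?_ ?_⟩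
  · rw [hl, length_shuffleWord]
  · rw [Zero_shuffleWord]
    ext i
    simp only [Finset.range_orderEmbOfFin, mem_image_val_succ, Finset.mem_coe, P,
      Finset.mem_filter, Finset.mem_univ, true_and, not_not]
    constructor
    · intro h
      have := Finset.mem_Icc.1 (hZ h)
      exact ⟨⟨i - 1, by omega⟩, by simpa [Nat.sub_add_cancel this.1] using h,
        by simp; omega⟩
    · rintro ⟨a, h, rfl⟩; exact h
  · rw [hP, Pos_shuffleWord]

/-! ### The fixed decomposition -/

theorem le_of_orderEmbedding {m n : ℕ} (ι : Fin m ↪o Fin n) : m ≤ n := by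
  simpa using Fintype.card_le_of_injective ι ι.injective

/-- The defining property of `reduce`: it is `σ`, read through the increasing numberings of the
positions `P` and of the letters `σ(P)`. -/
theorem orderEmbOfFin_reduce {n : ℕ} (σ : Perm (Fin n)) (P : Finset (Fin n))
    (j : Fin P.card) :
    (P.map σ.toEmbedding).orderEmbOfFin (Finset.card_map _) (reduce σ P j)
      = σ (P.orderEmbOfFin rfl j) := by
  rw [← Finset.coe_orderIsoOfFin_apply]
  simp [reduce]

/-- `σ` is built from the derangement `d`, carried over to the range of `ι`, and of the identity
on the complement. -/
structure IsFixDecomp {m n : ℕ} (σ : Perm (Fin n)) (d : Perm (Fin m)) (ι : Fin m ↪o Fin n) :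
    Prop where
  apply_emb : ∀ j, σ (ι j) = ι (d j)
  apply_of_notMem : ∀ i, i ∉ Set.range ι → σ i = i
  mem_derangements : d ∈ derangements (Fin m)

theorem IsFixDecomp.mem_range_iff {m n : ℕ} {σ : Perm (Fin n)} {d : Perm (Fin m)}
    {ι : Fin m ↪o Fin n} (h : IsFixDecomp σ d ι) (i : Fin n) : i ∈ Set.range ι ↔ σ i ≠ i := by
  constructor
  · rintro ⟨j, rfl⟩ e
    rw [h.apply_emb, ι.injective.eq_iff] at e
    exact h.mem_derangements j e
  · intro hi; by_contra hc; exact hi (h.apply_of_notMem i hc)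

/-- The fixed decomposition: `Der σ` and the places of the non-fixed letters. -/
def fixDecomp {n : ℕ} (σ : Perm (Fin n)) : Decomp n :=
  ⟨_, reduce σ (Finset.univ.filter fun i => σ i ≠ i),
    (Finset.univ.filter fun i => σ i ≠ i).orderEmbOfFin rfl⟩

theorem isFixDecomp_fixDecomp {n : ℕ} (σ : Perm (Fin n)) :
    IsFixDecomp σ (fixDecomp σ).2.1 (fixDecomp σ).2.2 := by
  have hmap : (Finset.univ.filter fun i => σ i ≠ i).map σ.toEmbedding
      = Finset.univ.filter fun i => σ i ≠ i := by
    ext i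
    simp only [Finset.mem_map_equiv, Finset.mem_filter, Finset.mem_univ, true_and]
    rw [Equiv.apply_symm_apply, not_iff_not, Equiv.eq_symm_apply, eq_comm]
  have hap : ∀ j, σ ((fixDecomp σ).2.2 j) = (fixDecomp σ).2.2 ((fixDecomp σ).2.1 j) := by
    intro j
    refine (orderEmbOfFin_reduce σ (Finset.univ.filter fun i => σ i ≠ i) j).symm.trans ?_
    simp only [hmap]; rfl
  have hr : ∀ i, i ∈ Set.range (fixDecomp σ).2.2 ↔ σ i ≠ i := by
    intro i
    have e : Set.range (fixDecomp σ).2.2 = ↑(Finset.univ.filter fun i => σ i ≠ i) :=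
      Finset.range_orderEmbOfFin _ rfl
    rw [e]; simp
  refine ⟨hap, fun i hi => by rwa [hr, not_not] at hi, fun j e => ?_⟩
  refine (hr _).1 ⟨j, rfl⟩ ?_
  rw [hap, e]

theorem IsFixDecomp.eq_fixDecomp {m n : ℕ} {σ : Perm (Fin n)} {d : Perm (Fin m)}
    {ι : Fin m ↪o Fin n} (h : IsFixDecomp σ d ι) : fixDecomp σ = ⟨m, d, ι⟩ := by
  have h' := isFixDecomp_fixDecomp σ
  generalize fixDecomp σ = D at h' ⊢
  obtain ⟨m', d', ι'⟩ := D
  dsimp only at h'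
  cases sigma_eq_of_range_eq (ι := ι') (ι' := ι)
    (by ext i; rw [h.mem_range_iff, h'.mem_range_iff])
  obtain rfl : d = d' := by
    ext1 j; apply ι.injective; rw [← h.apply_emb, ← h'.apply_emb]
  rfl

theorem IsFixDecomp.unique {m n : ℕ} {σ σ' : Perm (Fin n)} {d : Perm (Fin m)}
    {ι : Fin m ↪o Fin n} (h : IsFixDecomp σ d ι) (h' : IsFixDecomp σ' d ι) : σ = σ' := by
  ext1 i
  by_cases hi : i ∈ Set.range ι
  · obtain ⟨j, rfl⟩ := hi; rw [h.apply_emb, h'.apply_emb]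
  · rw [h.apply_of_notMem i hi, h'.apply_of_notMem i hi]

theorem exists_isFixDecomp {m n : ℕ} {d : Perm (Fin m)} (hd : d ∈ derangements (Fin m))
    (ι : Fin m ↪o Fin n) : ∃ σ, IsFixDecomp σ d ι := by
  classical
  refine ⟨d.extendDomain (Equiv.ofInjective ι ι.injective), fun j => ?_, fun i hi => ?_, hd⟩
  · exact Perm.extendDomain_apply_image d (Equiv.ofInjective ι ι.injective) j
  · exact Perm.extendDomain_apply_not_subtype _ _ hi

theorem ZDer_eq_shuffleWord {n : ℕ} (σ : Perm (Fin n)) :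
    ZDer σ = shuffleWord (fixDecomp σ).2.1 (fixDecomp σ).2.2 := by
  have h := isFixDecomp_fixDecomp σ
  generalize fixDecomp σ = D at h ⊢
  obtain ⟨m, d, ι⟩ := D
  dsimp only at *
  unfold ZDer shuffleWord
  congr 1; funext i
  by_cases hi : i ∈ Set.range ι
  · rw [if_neg ((h.mem_range_iff i).1 hi)]
    obtain ⟨j, rfl⟩ := hi
    rw [ι.injective.extend_apply, h.apply_emb, ← Fin.card_Iic (d j),
      ← Finset.card_map ι.toEmbedding]
    congr 1
    ext i
    simp only [Finset.mem_filter, Finset.mem_univ, true_and, Finset.mem_map, Finset.mem_Iic,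
      ← h.mem_range_iff]
    constructor
    · rintro ⟨⟨k, rfl⟩, hk⟩; exact ⟨k, by simpa using hk, rfl⟩
    · rintro ⟨k, hk, rfl⟩; exact ⟨⟨k, rfl⟩, by simpa using hk⟩
  · rw [Function.extend_apply' _ _ _ hi, if_pos (h.apply_of_notMem i hi)]; rfl

theorem Zero_ZDer {n : ℕ} (σ : Perm (Fin n)) : Zero (ZDer σ) = FIX σ := by
  classical
  rw [ZDer_eq_shuffleWord, Zero_shuffleWord, FIX]
  congr 1; apply Finset.filter_congr
  intro i _
  rw [(isFixDecomp_fixDecomp σ).mem_range_iff, not_not]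

theorem Pos_ZDer {n : ℕ} (σ : Perm (Fin n)) : Pos (ZDer σ) = word (Der σ).2 := by
  rw [ZDer_eq_shuffleWord, Pos_shuffleWord]; rfl

theorem length_ZDer {n : ℕ} (σ : Perm (Fin n)) : (ZDer σ).length = n := List.length_ofFn

theorem Der_mem_derangements {n : ℕ} (σ : Perm (Fin n)) :
    (Der σ).2 ∈ derangements (Fin (Der σ).1) := (isFixDecomp_fixDecomp σ).mem_derangements

theorem ZDer_injective {n : ℕ} : Function.Injective (ZDer : Perm (Fin n) → List ℕ) := by
  intro σ σ' h
  rw [ZDer_eq_shuffleWord, ZDer_eq_shuffleWord] at h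
  have e : fixDecomp σ = fixDecomp σ' := shuffleWord_injective h
  have h1 := isFixDecomp_fixDecomp σ
  rw [e] at h1
  exact h1.unique (isFixDecomp_fixDecomp σ')

theorem mem_SDer_iff {n : ℕ} {w : List ℕ} :
    w ∈ SDer n ↔ w.length = n ∧ ∃ m, ∃ d ∈ derangements (Fin m), Pos w = word d := by
  constructor
  · rintro ⟨m, hm, d, hd, hw⟩
    rw [mem_Sh_iff (fun x => pos_of_mem_word), length_word] at hw
    exact ⟨by omega, m, d, hd, hw.2⟩
  · rintro ⟨hl, m, d, hd, hP⟩
    have := card_Zero_add_length_Pos w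
    rw [hP, length_word] at this
    refine ⟨m, by omega, d, hd, ?_⟩
    rw [mem_Sh_iff (fun x => pos_of_mem_word), length_word]
    exact ⟨by omega, hP⟩

theorem bijOn_ZDer (n : ℕ) : Set.BijOn (ZDer : Perm (Fin n) → List ℕ) Set.univ (SDer n) := by
  refine ⟨fun σ _ => ?_, ZDer_injective.injOn, fun w hw => ?_⟩
  · exact mem_SDer_iff.2 ⟨length_ZDer σ, _, _, Der_mem_derangements σ, Pos_ZDer σ⟩
  · obtain ⟨hl, m, d, hd, hP⟩ := mem_SDer_iff.1 hw
    obtain ⟨ι, rfl⟩ := exists_eq_shuffleWord hl hP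
    obtain ⟨σ, hσ⟩ := exists_isFixDecomp hd ι
    exact ⟨σ, trivial, by rw [ZDer_eq_shuffleWord, hσ.eq_fixDecomp]⟩

/-! ### The pixed decomposition -/

theorem apply_inv_self {α : Type*} (f : Perm α) (x : α) : f (f⁻¹ x) = x := f.apply_symm_apply x

theorem inv_apply_self {α : Type*} (f : Perm α) (x : α) : f⁻¹ (f x) = x := f.symm_apply_apply x

/-- `r` is the length of the longest decreasing left factor of `y`, and an ascent follows unless this
factor is the whole word. -/
def IsRun (r : ℕ) (y : List ℕ) : Prop :=
  1 ≤ r ∧ r ≤ y.length ∧ (∀ i ∈ Finset.Ico 1 r, y.getD i 0 < y.getD (i - 1) 0) ∧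
    (r < y.length → y.getD (r - 1) 0 < y.getD r 0)

theorem isDesarrWord_iff_isRun {y : List ℕ} : IsDesarrWord y ↔ ∃ k, IsRun (2 * k) y := by
  constructor
  · rintro ⟨k, hk, h⟩
    rw [Finset.mem_Icc] at hk
    exact ⟨k, by omega, h⟩
  · rintro ⟨k, h0, h⟩
    exact ⟨k, Finset.mem_Icc.2 ⟨by omega, by have := h.1; omega⟩, h⟩

theorem IsRun.unique {r r' : ℕ} {y : List ℕ} (h : IsRun r y) (h' : IsRun r' y) : r = r' := by
  have key : ∀ {r r'}, IsRun r y → IsRun r' y → ¬ r < r' := by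
    intro r r' h h' hlt
    have h1 := h.2.2.2 (lt_of_lt_of_le hlt h'.2.1)
    have h2 := h'.2.2.1 r (Finset.mem_Ico.2 ⟨h.1, hlt⟩)
    omega
  have := key h h'
  have := key h' h
  omega

theorem isRun_succ_cons {r x : ℕ} {z : List ℕ} (hr : 1 ≤ r) :
    IsRun (r + 1) (x :: z) ↔ z.getD 0 0 < x ∧ IsRun r z := by
  obtain ⟨s, rfl⟩ : ∃ s, r = s + 1 := ⟨r - 1, by omega⟩
  simp only [IsRun, Finset.mem_Ico, List.length_cons]
  constructor
  · rintro ⟨-, h2, h3, h4⟩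
    refine ⟨by simpa using h3 1 (by omega), by omega, by omega, fun i hi => ?_, fun h => ?_⟩
    · obtain ⟨i, rfl⟩ : ∃ t, i = t + 1 := ⟨i - 1, by omega⟩
      simpa using h3 (i + 2) (by omega)
    · simpa using h4 (by omega)
  · rintro ⟨h1, -, h2, h3, h4⟩
    refine ⟨by omega, by omega, fun i hi => ?_, fun h => ?_⟩
    · obtain ⟨i, rfl⟩ : ∃ t, i = t + 1 := ⟨i - 1, by omega⟩
      rcases Nat.eq_zero_or_pos i with rfl | hi0
      · simpa using h1
      · obtain ⟨i, rfl⟩ : ∃ t, i = t + 1 := ⟨i - 1, by omega⟩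
        simpa using h3 (i + 1) (by omega)
    · simpa using h4 (by omega)

theorem isRun_one_cons {x : ℕ} {z : List ℕ} :
    IsRun 1 (x :: z) ↔ (z ≠ [] → x < z.getD 0 0) := by
  simp [IsRun, List.length_pos_iff]

/-- The word has no repetitions, so its longest decreasing left factor is followed by an ascent. -/
theorem exists_isRun {y : List ℕ} (hy : y.Nodup) (h0 : y ≠ []) : ∃ r, IsRun r y := by
  induction y with
  | nil => exact absurd rfl h0
  | cons x z ih =>
    by_cases hz : z ≠ [] ∧ z.getD 0 0 < x
    · obtain ⟨r, hr⟩ := ih hy.of_cons hz.1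
      exact ⟨r + 1, (isRun_succ_cons hr.1).2 ⟨hz.2, hr⟩⟩
    · refine ⟨1, isRun_one_cons.2 fun hne => ?_⟩
      obtain ⟨a, z, rfl⟩ := List.exists_cons_of_ne_nil hne
      have : x ≠ a := by rintro rfl; simp at hy
      simp at hz ⊢
      omega

/-- The rule by which the right factors of a word that are desarrangements are found from right to
left: being a desarrangement alternates along each descent. -/
theorem isDesarrWord_cons {x : ℕ} {z : List ℕ} (h : (x :: z).Nodup) :
    IsDesarrWord (x :: z) ↔ z ≠ [] ∧ z.getD 0 0 < x ∧ ¬ IsDesarrWord z := by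
  rw [isDesarrWord_iff_isRun, isDesarrWord_iff_isRun]
  constructor
  · rintro ⟨k, hk⟩
    obtain ⟨r, hr⟩ : ∃ r, 2 * k = r + 1 := ⟨2 * k - 1, by have := hk.1; omega⟩
    rw [hr] at hk
    rw [isRun_succ_cons (by omega)] at hk
    refine ⟨?_, hk.1, ?_⟩
    · rintro rfl
      have := hk.2.1
      have := hk.2.2.1
      simp at this; omega
    · rintro ⟨k', hk'⟩
      have := hk'.unique hk.2
      omega
  · rintro ⟨hz, hlt, hE⟩
    obtain ⟨r, hr⟩ := exists_isRun h.of_cons hz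
    rcases Nat.even_or_odd' r with ⟨k, rfl | rfl⟩
    · exact absurd ⟨k, hr⟩ hE
    · exact ⟨k + 1, (isRun_succ_cons (r := 2 * k + 1) (by omega)).2 ⟨hlt, hr⟩⟩

theorem isDesarrWord_congr {y y' : List ℕ} (hl : y.length = y'.length)
    (h : ∀ i j, i < y.length → j < y.length →
      (y.getD i 0 < y.getD j 0 ↔ y'.getD i 0 < y'.getD j 0)) :
    IsDesarrWord y ↔ IsDesarrWord y' := by
  unfold IsDesarrWord
  rw [hl] at *
  refine exists_congr fun k => and_congr_right fun hk => and_congr_right fun hk2 =>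
    and_congr (forall₂_congr fun i hi => ?_) (forall_congr' fun hk3 => ?_)
  · rw [Finset.mem_Ico] at hi; exact h _ _ (by omega) (by omega)
  · exact h _ _ (by omega) (by omega)

theorem word_getD {n : ℕ} (σ : Perm (Fin n)) {i : ℕ} (hi : i < n) :
    (word σ).getD i 0 = (σ ⟨i, hi⟩ : ℕ) + 1 := getD_ofFn (fun i => (σ i : ℕ) + 1) ⟨i, hi⟩

theorem word_nodup {n : ℕ} (σ : Perm (Fin n)) : (word σ).Nodup :=
  List.nodup_ofFn.2 fun a b h => σ.injective (Fin.ext (by simpa using h))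

theorem getD_drop (l : List ℕ) (p i : ℕ) : (l.drop p).getD i 0 = l.getD (p + i) 0 := by
  simp [List.getD_eq_getElem?_getD, List.getElem?_drop]

theorem isDesarrWord_drop_word {n : ℕ} (σ : Perm (Fin n)) (p : ℕ) :
    IsDesarrWord ((word σ).drop p) ↔ p + 1 < n ∧
      (word σ).getD (p + 1) 0 < (word σ).getD p 0 ∧ ¬ IsDesarrWord ((word σ).drop (p + 1)) := by
  by_cases hp : p < n
  · have hp' : p < (word σ).length := by rwa [length_word]
    have hnd : ((word σ).drop p).Nodup := (word_nodup σ).sublist (List.drop_sublist _ _)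
    rw [List.drop_eq_getElem_cons hp'] at hnd ⊢
    rw [isDesarrWord_cons hnd, getD_drop, List.getD_eq_getElem _ _ hp', Nat.add_zero, Ne,
      List.drop_eq_nil_iff, length_word, not_le]
  · rw [List.drop_of_length_le (by rw [length_word]; omega)]
    constructor
    · rintro ⟨k, hk, -⟩; simp at hk
    · rintro ⟨h, -⟩; omega

/-- The pixed factorization: the left factor is increasing, and the right factor is empty or a
desarrangement. -/
theorem pixLength_eq_iff {n : ℕ} (σ : Perm (Fin n)) (p : ℕ) :
    pixLength σ = p ↔ p ≤ n ∧ (∀ i j : Fin n, i < j → (j : ℕ) < p → σ i < σ j) ∧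
      (IsDesarrWord ((word σ).drop p) ∨ p = n) := by
  rw [pixLength, Nat.find_eq_iff]
  have hlt : ∀ q, (hq : q + 1 < n) →
      ((word σ).getD (q + 1) 0 < (word σ).getD q 0 ↔
        σ ⟨q + 1, hq⟩ < σ ⟨q, by omega⟩) := by
    intro q hq
    rw [word_getD σ hq, word_getD σ (show q < n by omega), Fin.lt_def]; omega
  constructor
  · rintro ⟨h1, h2⟩
    have hpn : p ≤ n := by
      by_contra hc; exact h2 n (by omega) (Or.inr rfl)
    refine ⟨hpn, ?_, h1⟩
    have step : ∀ q, (hq : q + 1 < p) →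
        σ ⟨q, by omega⟩ < σ ⟨q + 1, by omega⟩ := by
      intro q hq
      have ha := fun h => h2 q (by omega) (Or.inl h)
      have hb := fun h => h2 (q + 1) hq (Or.inl h)
      rw [isDesarrWord_drop_word, hlt q (by omega)] at ha
      refine lt_of_le_of_ne (not_lt.1 fun h => ha ⟨by omega, h, hb⟩) fun e => ?_
      have := congrArg Fin.val (σ.injective e)
      simp at this
    rintro ⟨i, hi⟩ ⟨j, hj⟩ hij hjp
    rw [Fin.mk_lt_mk] at hij
    dsimp only at hjp
    induction j, hij using Nat.le_induction with
    | base => exact step i hjp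
    | succ j hij ih => exact (ih (by omega) (by omega)).trans (step j hjp)
  · rintro ⟨hpn, hinc, h1⟩
    refine ⟨h1, fun q hq => ?_⟩
    rintro (hE | rfl)
    · rw [isDesarrWord_drop_word] at hE
      obtain ⟨hq1, hd, hE⟩ := hE
      rw [hlt q hq1] at hd
      rcases Nat.lt_or_ge (q + 1) p with h | h
      · exact lt_asymm hd (hinc _ _ (Fin.mk_lt_mk.2 (Nat.lt_succ_self q)) h)
      · obtain rfl : p = q + 1 := by omega
        rcases h1 with h1 | h1
        · exact hE h1
        · omega
    · omega

theorem mem_desarrangements_iff {m : ℕ} {d : Perm (Fin m)} :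
    d ∈ desarrangements m ↔ IsDesarrWord (word d) ∨ m = 0 := by
  have h : d ∈ desarrangements m ↔ pixLength d = 0 := by
    rw [desarrangements, Set.mem_ofPred_eq, PIX, Finset.image_eq_empty,
      Finset.filter_eq_empty_iff]
    constructor
    · intro h
      have hle := ((pixLength_eq_iff d _).1 rfl).1
      rcases Nat.eq_zero_or_pos m with h0 | h0
      · omega
      · simpa using h (Finset.mem_univ ⟨0, h0⟩)
    · intro h i _; omega
  rw [h, pixLength_eq_iff, List.drop_zero]
  constructor
  · rintro ⟨-, -, h⟩; tauto
  · intro h; exact ⟨Nat.zero_le _, fun i j _ hj => absurd hj (Nat.not_lt_zero _), by tauto⟩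

/-- The permutation `τ` is the inverse of a permutation whose word is the increasing word of the
letters outside the range of `ι`, followed by the word `ι ∘ e⁻¹`, where `e⁻¹` is a
desarrangement. -/
structure IsPixDecomp {m n : ℕ} (τ : Perm (Fin n)) (e : Perm (Fin m)) (ι : Fin m ↪o Fin n) :
    Prop where
  apply_emb : ∀ j, (τ (ι j) : ℕ) = n - m + e j
  lt_of_notMem : ∀ x y, x ∉ Set.range ι → y ∉ Set.range ι → x < y → τ x < τ y
  mem_desarrangements : e⁻¹ ∈ desarrangements m

section

variable {m n : ℕ} {τ τ' : Perm (Fin n)} {e : Perm (Fin m)} {ι : Fin m ↪o Fin n}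

theorem IsPixDecomp.mem_range_iff (h : IsPixDecomp τ e ι) (i : Fin n) :
    i ∈ Set.range ι ↔ n - m ≤ τ i := by
  constructor
  · rintro ⟨j, rfl⟩; rw [h.apply_emb]; omega
  · intro hi
    have := (τ i).2
    refine ⟨e⁻¹ ⟨τ i - (n - m), by omega⟩, τ.injective (Fin.ext ?_)⟩
    rw [h.apply_emb]; simp; omega

theorem IsPixDecomp.apply_lt_of_notMem (h : IsPixDecomp τ e ι) {i : Fin n}
    (hi : i ∉ Set.range ι) : (τ i : ℕ) < n - m := by
  rwa [h.mem_range_iff, not_le] at hi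

theorem IsPixDecomp.unique (h : IsPixDecomp τ e ι) (h' : IsPixDecomp τ' e ι) : τ = τ' := by
  classical
  let N : Finset (Fin n) := Finset.univ.filter fun i => i ∉ Set.range ι
  let κ := N.orderEmbOfFin rfl
  have hκ : ∀ j, κ j ∉ Set.range ι := fun j =>
    (Finset.mem_filter.1 (Finset.orderEmbOfFin_mem N rfl j)).2
  have hκr : ∀ i, i ∉ Set.range ι → i ∈ Set.range κ := by
    intro i hi; simpa [κ, Finset.range_orderEmbOfFin, N] using hi
  have key : ∀ {τ : Perm (Fin n)}, IsPixDecomp τ e ι → StrictMono (τ ∘ κ) ∧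
      Set.range (τ ∘ κ) = {i : Fin n | (i : ℕ) < n - m} := by
    intro τ h
    refine ⟨fun a b hab => h.lt_of_notMem _ _ (hκ a) (hκ b) (κ.strictMono hab), ?_⟩
    ext i
    constructor
    · rintro ⟨j, rfl⟩; exact h.apply_lt_of_notMem (hκ j)
    · intro hi
      obtain ⟨j, hj⟩ := hκr (τ⁻¹ i) (by rw [h.mem_range_iff, apply_inv_self, not_le]; exact hi)
      exact ⟨j, by simp [hj]⟩
  have hEq : τ ∘ κ = τ' ∘ κ :=
    (StrictMono.range_inj (key h).1 (key h').1).1 ((key h).2.trans (key h').2.symm)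
  ext1 i
  by_cases hi : i ∈ Set.range ι
  · obtain ⟨j, rfl⟩ := hi
    exact Fin.ext (by rw [h.apply_emb, h'.apply_emb])
  · obtain ⟨j, rfl⟩ := hκr i hi
    exact congrFun hEq j

theorem exists_isPixDecomp (he : e⁻¹ ∈ desarrangements m) (ι : Fin m ↪o Fin n) :
    ∃ τ, IsPixDecomp τ e ι := by
  have hmn := le_of_orderEmbedding ι
  let N : Finset (Fin n) := Finset.univ.map ι.toEmbedding
  have hN : N.card = m := by simp [N]
  have hNc : Nᶜ.card = n - m := by rw [Finset.card_compl, hN, Fintype.card_fin]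
  have hι : N.orderEmbOfFin hN = ι := by
    have := Finset.orderEmbOfFin_unique hN (f := ι) (fun j => by simp [N]) ι.strictMono
    exact DFunLike.coe_injective this.symm
  have hmem : ∀ i, i ∉ Set.range ι → ∃ k, Nᶜ.orderEmbOfFin hNc k = i := by
    intro i hi
    have : i ∈ Set.range (Nᶜ.orderEmbOfFin hNc) := by
      rw [Finset.range_orderEmbOfFin]; simpa [N] using hi
    exact this
  let E : Fin m ⊕ Fin (n - m) ≃ Fin n := finSumEquivOfFinset hN hNc
  let G : Fin m ⊕ Fin (n - m) ≃ Fin n :=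
    ((e.sumCongr (Equiv.refl _)).trans (Equiv.sumComm _ _)).trans
      (finSumFinEquiv.trans (finCongr (by omega)))
  have hl : ∀ j, E.symm (ι j) = Sum.inl j := by
    intro j; rw [Equiv.symm_apply_eq]; simp [E, hι]
  have hr : ∀ k, E.symm (Nᶜ.orderEmbOfFin hNc k) = Sum.inr k := by
    intro j; rw [Equiv.symm_apply_eq]; simp [E]
  refine ⟨E.symm.trans G, ?_, ?_, he⟩
  · intro j
    rw [Equiv.trans_apply, hl]; simp [G]
  · intro x y hx hy hxy
    obtain ⟨a, rfl⟩ := hmem x hx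
    obtain ⟨b, rfl⟩ := hmem y hy
    have hG : ∀ k, ((E.symm.trans G) (Nᶜ.orderEmbOfFin hNc k) : ℕ) = k := by
      intro k; rw [Equiv.trans_apply, hr]; simp [G]
    rw [Fin.lt_def, hG, hG]
    exact (Nᶜ.orderEmbOfFin hNc).lt_iff_lt.1 hxy

theorem IsPixDecomp.pixLength_inv (h : IsPixDecomp τ e ι) : pixLength τ⁻¹ = n - m := by
  have hmn := le_of_orderEmbedding ι
  rw [pixLength_eq_iff]
  refine ⟨Nat.sub_le _ _, ?_, ?_⟩
  · intro i j hij hj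
    have hn : ∀ k : Fin n, (k : ℕ) < n - m → τ⁻¹ k ∉ Set.range ι := by
      intro k hk; rw [h.mem_range_iff, apply_inv_self, not_le]; exact hk
    have hi : (i : ℕ) < n - m := lt_trans hij hj
    rcases lt_trichotomy (τ⁻¹ i) (τ⁻¹ j) with hlt | he | hgt
    · exact hlt
    · exact absurd (τ⁻¹.injective he) hij.ne
    · have := h.lt_of_notMem _ _ (hn j hj) (hn i hi) hgt
      rw [apply_inv_self, apply_inv_self] at this
      exact absurd this (lt_asymm hij)
  · rcases mem_desarrangements_iff.1 h.mem_desarrangements with hE | h0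
    · left
      refine (isDesarrWord_congr ?_ ?_).1 hE
      · rw [List.length_drop, length_word, length_word]; omega
      · intro i j hi hj
        rw [length_word] at hi hj
        have hv : ∀ k : Fin m, τ⁻¹ ⟨n - m + k, by omega⟩ = ι (e⁻¹ k) := by
          intro k
          rw [Perm.inv_eq_iff_eq]
          exact Fin.ext (by rw [h.apply_emb, apply_inv_self])
        rw [getD_drop, getD_drop, word_getD _ hi, word_getD _ hj,
          word_getD _ (show n - m + i < n by omega), word_getD _ (show n - m + j < n by omega),
          hv ⟨i, hi⟩, hv ⟨j, hj⟩, Nat.add_lt_add_iff_right, Nat.add_lt_add_iff_right,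
          ← Fin.lt_def, ← Fin.lt_def, ι.lt_iff_lt]
    · right; omega

end

/-- The pixed decomposition: the inverse of `Desar σ` and the set of the letters of the right
factor, as an embedding. -/
def pixDecomp {n : ℕ} (σ : Perm (Fin n)) : Decomp n :=
  ⟨_, (reduce σ (Finset.univ.filter fun i => pixLength σ ≤ i))⁻¹,
    ((Finset.univ.filter fun i : Fin n => pixLength σ ≤ i).map σ.toEmbedding).orderEmbOfFin
      (Finset.card_map _)⟩

theorem isPixDecomp_pixDecomp {n : ℕ} (σ : Perm (Fin n)) :
    IsPixDecomp σ⁻¹ (pixDecomp σ).2.1 (pixDecomp σ).2.2 := by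
  obtain ⟨hpn, hinc, hE⟩ := (pixLength_eq_iff σ _).1 rfl
  have hcard : (Finset.univ.filter fun i : Fin n => pixLength σ ≤ i).card
      = n - pixLength σ := by
    rw [← Nat.card_Ico, ← Finset.card_map Fin.valEmbedding]
    congr 1
    ext i
    simp only [Finset.mem_map, Finset.mem_filter, Finset.mem_univ, true_and, Finset.mem_Ico,
      Fin.valEmbedding_apply]
    constructor
    · rintro ⟨a, h, rfl⟩; exact ⟨h, a.2⟩
    · rintro ⟨h1, h2⟩; exact ⟨⟨i, h2⟩, h1, rfl⟩
  have hmem : ∀ i, i ∈ Set.range (pixDecomp σ).2.2 ↔ pixLength σ ≤ σ⁻¹ i := by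
    intro i
    have e : Set.range (pixDecomp σ).2.2
        = ↑((Finset.univ.filter fun i : Fin n => pixLength σ ≤ i).map σ.toEmbedding) :=
      Finset.range_orderEmbOfFin _ (Finset.card_map _)
    rw [e, Finset.mem_coe, Finset.mem_map_equiv, Finset.mem_filter]
    exact and_iff_right (Finset.mem_univ _)
  have hm : (pixDecomp σ).1 = n - pixLength σ := hcard
  have hv : ∀ j : Fin (pixDecomp σ).1,
      (σ⁻¹ ((pixDecomp σ).2.2 ((pixDecomp σ).2.1⁻¹ j)) : ℕ) = pixLength σ + j := by
    intro j
    have hu := Finset.orderEmbOfFin_unique (s := Finset.univ.filter fun i : Fin n =>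
      pixLength σ ≤ i) rfl
      (f := fun j => ⟨pixLength σ + j, by have := j.2; omega⟩) (by intro j; simp)
      (by intro a b hab; rw [Fin.mk_lt_mk]; have : (a : ℕ) < b := hab; omega)
    have hr : σ⁻¹ ((pixDecomp σ).2.2 ((pixDecomp σ).2.1⁻¹ j))
        = (Finset.univ.filter fun i : Fin n => pixLength σ ≤ i).orderEmbOfFin rfl j := by
      rw [Perm.inv_eq_iff_eq]
      exact orderEmbOfFin_reduce σ (Finset.univ.filter fun i : Fin n => pixLength σ ≤ i) j
    rw [hr, ← hu]
  refine ⟨fun j => ?_, fun x y hx hy hxy => ?_, ?_⟩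
  · have := hv ((pixDecomp σ).2.1 j)
    rw [inv_apply_self] at this
    omega
  · rw [hmem, not_le] at hx hy
    rcases lt_trichotomy (σ⁻¹ x) (σ⁻¹ y) with hlt | he | hgt
    · exact hlt
    · exact absurd (σ⁻¹.injective he) hxy.ne
    · have := hinc _ _ hgt hx
      rw [apply_inv_self, apply_inv_self] at this
      exact absurd this (lt_asymm hxy)
  · rw [mem_desarrangements_iff]
    refine hE.imp (fun hE => ?_) (fun hE => by omega)
    refine (isDesarrWord_congr ?_ ?_).2 hE
    · rw [List.length_drop, length_word, length_word]; omega
    · intro i j hi hj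
      rw [length_word] at hi hj
      have hv' : ∀ k : Fin (pixDecomp σ).1, σ ⟨pixLength σ + k, by omega⟩
          = (pixDecomp σ).2.2 ((pixDecomp σ).2.1⁻¹ k) := by
        intro k
        rw [← Perm.eq_inv_iff_eq]
        exact Fin.ext (hv k).symm
      rw [getD_drop, getD_drop, word_getD _ hi, word_getD _ hj,
        word_getD _ (show pixLength σ + i < n by omega),
        word_getD _ (show pixLength σ + j < n by omega),
        hv' ⟨i, hi⟩, hv' ⟨j, hj⟩, Nat.add_lt_add_iff_right, Nat.add_lt_add_iff_right,
        ← Fin.lt_def, ← Fin.lt_def, OrderEmbedding.lt_iff_lt]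

theorem IsPixDecomp.eq_pixDecomp {m n : ℕ} {τ : Perm (Fin n)} {e : Perm (Fin m)}
    {ι : Fin m ↪o Fin n} (h : IsPixDecomp τ e ι) : pixDecomp τ⁻¹ = ⟨m, e, ι⟩ := by
  have h' := isPixDecomp_pixDecomp τ⁻¹
  rw [inv_inv] at h'
  generalize pixDecomp τ⁻¹ = D at h' ⊢
  obtain ⟨m', e', ι'⟩ := D
  dsimp only at h'
  have hm : n - m' = n - m := h'.pixLength_inv.symm.trans h.pixLength_inv
  cases sigma_eq_of_range_eq (ι := ι') (ι' := ι)
    (by ext i; rw [h.mem_range_iff, h'.mem_range_iff, hm])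
  obtain rfl : e = e' := by
    ext j
    have h1 := h.apply_emb j
    have h2 := h'.apply_emb j
    omega
  rfl

theorem length_shuf (n : ℕ) (Z : Finset ℕ) (v : List ℕ) : (shuf n Z v).length = n := by
  simp [shuf]

theorem PIX_eq_Zero {n : ℕ} (σ : Perm (Fin n)) :
    PIX σ = Zero (shuffleWord (pixDecomp σ).2.1 (pixDecomp σ).2.2) := by
  classical
  have h := isPixDecomp_pixDecomp σ
  have hp := h.pixLength_inv
  rw [inv_inv] at hp
  rw [Zero_shuffleWord]
  ext i
  rw [PIX]
  simp only [Finset.mem_image, Finset.mem_filter, Finset.mem_univ, true_and, h.mem_range_iff,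
    ← hp, not_le]
  constructor
  · rintro ⟨a, ha, rfl⟩; exact ⟨σ a, by simpa using ha, rfl⟩
  · rintro ⟨a, ha, rfl⟩; exact ⟨σ⁻¹ a, ha, by simp⟩

theorem ZDesar_eq_shuffleWord {n : ℕ} (σ : Perm (Fin n)) :
    ZDesar σ = shuffleWord (pixDecomp σ).2.1 (pixDecomp σ).2.2 := by
  have hP := Pos_shuffleWord (pixDecomp σ).2.1 (pixDecomp σ).2.2
  conv_rhs => rw [← shuf_Zero_Pos (shuffleWord _ _), ← PIX_eq_Zero, hP, length_shuffleWord]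
  rfl

theorem Zero_ZDesar {n : ℕ} (σ : Perm (Fin n)) : Zero (ZDesar σ) = PIX σ := by
  rw [ZDesar_eq_shuffleWord, PIX_eq_Zero]

theorem Pos_ZDesar {n : ℕ} (σ : Perm (Fin n)) : Pos (ZDesar σ) = word (Desar σ).2⁻¹ := by
  rw [ZDesar_eq_shuffleWord, Pos_shuffleWord]; rfl

theorem length_ZDesar {n : ℕ} (σ : Perm (Fin n)) : (ZDesar σ).length = n := length_shuf _ _ _

theorem Desar_mem_desarrangements {n : ℕ} (σ : Perm (Fin n)) :
    (Desar σ).2 ∈ desarrangements (Desar σ).1 := by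
  have := (isPixDecomp_pixDecomp σ).mem_desarrangements
  exact this

theorem ZDesar_injective {n : ℕ} : Function.Injective (ZDesar : Perm (Fin n) → List ℕ) := by
  intro σ σ' h
  rw [ZDesar_eq_shuffleWord, ZDesar_eq_shuffleWord] at h
  have e : pixDecomp σ = pixDecomp σ' := shuffleWord_injective h
  have h1 := isPixDecomp_pixDecomp σ
  rw [e] at h1
  exact inv_injective (h1.unique (isPixDecomp_pixDecomp σ'))

theorem mem_SDesar_iff {n : ℕ} {w : List ℕ} :
    w ∈ SDesar n ↔ w.length = n ∧ ∃ m, ∃ d ∈ desarrangements m, Pos w = word d⁻¹ := by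
  constructor
  · rintro ⟨m, hm, d, hd, hw⟩
    rw [mem_Sh_iff (fun x => pos_of_mem_word), length_word] at hw
    exact ⟨by omega, m, d, hd, hw.2⟩
  · rintro ⟨hl, m, d, hd, hP⟩
    have := card_Zero_add_length_Pos w
    rw [hP, length_word] at this
    refine ⟨m, by omega, d, hd, ?_⟩
    rw [mem_Sh_iff (fun x => pos_of_mem_word), length_word]
    exact ⟨by omega, hP⟩

theorem bijOn_ZDesar (n : ℕ) :
    Set.BijOn (ZDesar : Perm (Fin n) → List ℕ) Set.univ (SDesar n) := by
  refine ⟨fun σ _ => ?_, ZDesar_injective.injOn, fun w hw => ?_⟩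
  · exact mem_SDesar_iff.2 ⟨length_ZDesar σ, _, _, Desar_mem_desarrangements σ, Pos_ZDesar σ⟩
  · obtain ⟨hl, m, d, hd, hP⟩ := mem_SDesar_iff.1 hw
    obtain ⟨ι, rfl⟩ := exists_eq_shuffleWord hl hP
    obtain ⟨τ, hτ⟩ := exists_isPixDecomp (e := d⁻¹) (by rwa [inv_inv]) ι
    exact ⟨τ⁻¹, trivial, by rw [ZDesar_eq_shuffleWord, hτ.eq_pixDecomp]⟩

/-- In `ZDesar σ` a descent at `i` means that `i + 1` is to the left of `i` in `σ`: the letters of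
the increasing left factor come first, and they are replaced by zeros. -/
theorem wDES_ZDesar {n : ℕ} (σ : Perm (Fin n)) : wDES (ZDesar σ) = IDES σ := by
  have h := isPixDecomp_pixDecomp σ
  rw [ZDesar_eq_shuffleWord, IDES, DES]
  generalize pixDecomp σ = D at h ⊢
  obtain ⟨m, e, ι⟩ := D
  dsimp only at *
  ext i
  rw [mem_wDES, mem_wDES, length_shuffleWord, length_word]
  refine and_congr_right fun h1 => and_congr_right fun h2 => ?_
  have hx : i - 1 < n := by omega
  rw [word_getD _ h2, word_getD _ hx, shuffleWord, getD_ofFn _ ⟨i, h2⟩, getD_ofFn _ ⟨i - 1, hx⟩]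
  have hlt : (⟨i - 1, hx⟩ : Fin n) < ⟨i, h2⟩ := Fin.mk_lt_mk.2 (by omega)
  generalize (⟨i - 1, hx⟩ : Fin n) = x at *
  generalize (⟨i, h2⟩ : Fin n) = y at *
  by_cases hx : x ∈ Set.range ι <;> by_cases hy : y ∈ Set.range ι
  · obtain ⟨a, rfl⟩ := hx
    obtain ⟨b, rfl⟩ := hy
    rw [ι.injective.extend_apply, ι.injective.extend_apply, h.apply_emb, h.apply_emb]
    omega
  · have h0 := (extend_pos_iff e ι x).2 hx
    rw [Function.extend_apply' _ _ y hy]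
    have := h.apply_lt_of_notMem hy
    have := (h.mem_range_iff x).1 hx
    simp only [Pi.zero_apply, h0, true_iff]; omega
  · rw [Function.extend_apply' _ _ x hx]
    have := h.apply_lt_of_notMem hx
    have := (h.mem_range_iff y).1 hy
    simp only [Pi.zero_apply, Nat.not_lt_zero, false_iff]; omega
  · rw [Function.extend_apply' _ _ x hx, Function.extend_apply' _ _ y hy]
    have := h.lt_of_notMem x y hx hy hlt
    rw [Fin.lt_def] at this
    simp only [Pi.zero_apply, Nat.not_lt_zero, false_iff]; omega

/-! ### Placing letters in the fibres of a monotone function -/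

/-- `σ` is increasing on each fibre of `b`. -/
def IncOn {n : ℕ} (b : Fin n → ℕ) (σ : Perm (Fin n)) : Prop :=
  ∀ i j, i < j → b i = b j → σ i < σ j

/-- In each fibre of `b`, no element outside the range of `ι` precedes a `low` letter, or follows a
letter that is not `low`. -/
structure IsPlaced {m n : ℕ} (b : Fin n → ℕ) (low : Fin m → Prop) (ι : Fin m ↪o Fin n) :
    Prop where
  mem_of_lt : ∀ j, low j → ∀ i, i < ι j → b i = b (ι j) → i ∈ Set.range ι
  mem_of_gt : ∀ j, ¬ low j → ∀ i, ι j < i → b i = b (ι j) → i ∈ Set.range ι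

theorem strictMono_update {m n : ℕ} (ι : Fin m ↪o Fin n) {j : Fin m} {i : Fin n}
    (h1 : ∀ k, k < j → ι k < i) (h2 : ∀ k, j < k → i < ι k) :
    StrictMono (Function.update ι j i) := by
  intro a c hac
  by_cases ha : a = j
  · subst ha
    rw [Function.update_self, Function.update_of_ne hac.ne']; exact h2 c hac
  · rw [Function.update_of_ne ha]
    by_cases hc : c = j
    · subst hc; rw [Function.update_self]; exact h1 a hac
    · rw [Function.update_of_ne hc]; exact ι.strictMono hac

/-- Two placements agree on the low letters by induction from the left, and on the others by
induction from the right. -/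
theorem IsPlaced.unique {m n : ℕ} {b : Fin n → ℕ} {low : Fin m → Prop} {ι ι' : Fin m ↪o Fin n}
    (h : IsPlaced b low ι) (h' : IsPlaced b low ι') (hb : b ∘ ι = b ∘ ι')
    (hlow : ∀ j j', j < j' → b (ι j) = b (ι j') → low j' → low j) : ι = ι' := by
  have hb' : ∀ j, b (ι j) = b (ι' j) := congrFun hb
  have keyL : ∀ {κ κ' : Fin m ↪o Fin n}, IsPlaced b low κ' →
      (∀ j, b (κ j) = b (κ' j)) → (∀ j j', j < j' → b (κ j) = b (κ j') → low j' → low j) →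
      ∀ j, low j → (∀ k < j, low k → κ k = κ' k) → ¬ κ j < κ' j := by
    intro κ κ' h hb hlow j hj ih hlt
    obtain ⟨k, hk⟩ := h.mem_of_lt j hj _ hlt (hb j)
    have hkj : k < j := by rw [← hk] at hlt; exact κ'.lt_iff_lt.1 hlt
    have e := ih k hkj (hlow k j hkj (by rw [hb k, hk]) hj)
    rw [← e] at hk
    exact hkj.ne (κ.injective hk)
  have keyH : ∀ {κ κ' : Fin m ↪o Fin n}, IsPlaced b low κ' →
      (∀ j, b (κ j) = b (κ' j)) → (∀ j j', j < j' → b (κ j) = b (κ j') → low j' → low j) →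
      ∀ j, ¬ low j → (∀ k > j, ¬ low k → κ k = κ' k) → ¬ κ' j < κ j := by
    intro κ κ' h hb hlow j hj ih hlt
    obtain ⟨k, hk⟩ := h.mem_of_gt j hj _ hlt (hb j)
    have hkj : j < k := by rw [← hk] at hlt; exact κ'.lt_iff_lt.1 hlt
    have e := ih k hkj fun hl => hj (hlow j k hkj (by rw [hb k, hk]) hl)
    rw [← e] at hk
    exact hkj.ne' (κ.injective hk)
  have hlow' : ∀ j j', j < j' → b (ι' j) = b (ι' j') → low j' → low j := by
    intro j j' hj e; rw [← hb', ← hb'] at e; exact hlow j j' hj e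
  ext1 j
  by_cases hj : low j
  · induction j using WellFoundedLT.induction with
    | ind j ih =>
      rcases lt_trichotomy (ι j) (ι' j) with hlt | e | hgt
      · exact absurd hlt (keyL h' hb' hlow j hj ih)
      · exact e
      · exact absurd hgt (keyL h (fun k => (hb' k).symm) hlow' j hj
          fun k hk hl => (ih k hk hl).symm)
  · induction j using WellFoundedGT.induction with
    | ind j ih =>
      rcases lt_trichotomy (ι j) (ι' j) with hlt | e | hgt
      · exact absurd hlt (keyH h (fun k => (hb' k).symm) hlow' j hj
          fun k hk hl => (ih k hk hl).symm)
      · exact e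
      · exact absurd hgt (keyH h' hb' hlow j hj ih)

theorem exists_isPlaced {m n : ℕ} {b : Fin n → ℕ} (hb : Monotone b) {low : Fin m → Prop}
    (ι : Fin m ↪o Fin n) (hlow : ∀ j j', j < j' → b (ι j) = b (ι j') → low j' → low j) :
    ∃ κ : Fin m ↪o Fin n, b ∘ κ = b ∘ ι ∧ IsPlaced b low κ := by
  classical
  -- Moving a low letter to the left, or another letter to the right, inside its fibre lowers `f`.
  let f : (Fin m → Fin n) → ℕ := fun κ => ∑ j, if low j then (κ j : ℕ) else n - κ j
  induction hk : f ι using Nat.strong_induction_on generalizing ι with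
  | _ k ih =>
  subst hk
  have move : ∀ (j : Fin m) (i : Fin n), b i = b (ι j) →
      (∀ k, k < j → ι k < i) → (∀ k, j < k → i < ι k) →
      ((low j ∧ i < ι j) ∨ (¬ low j ∧ ι j < i)) →
      ∃ κ : Fin m ↪o Fin n, b ∘ κ = b ∘ ι ∧ IsPlaced b low κ := by
    intro j i hbi h1 h2 h3
    let κ := OrderEmbedding.ofStrictMono _ (strictMono_update ι h1 h2)
    have hκ : ∀ k, κ k = if k = j then i else ι k := fun k => by
      simp [κ, Function.update_apply]
    have hbκ : b ∘ κ = b ∘ ι := by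
      funext k
      simp only [Function.comp_apply, hκ]
      split_ifs with hk
      · rw [hk, hbi]
      · rfl
    have hbκ' := congrFun hbκ
    simp only [Function.comp_apply] at hbκ'
    have hlt : f κ < f ι := by
      apply Finset.sum_lt_sum
      · intro k _
        rw [hκ]
        by_cases hk : k = j
        · subst hk
          rw [if_pos rfl]
          rcases h3 with ⟨hl, h⟩ | ⟨hl, h⟩ <;> simp only [hl, if_true, if_false] <;>
            (rw [Fin.lt_def] at h; omega)
        · rw [if_neg hk]
      · refine ⟨j, Finset.mem_univ _, ?_⟩
        rw [hκ, if_pos rfl]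
        rcases h3 with ⟨hl, h⟩ | ⟨hl, h⟩ <;> simp only [hl, if_true, if_false] <;>
          (rw [Fin.lt_def] at h; omega)
    obtain ⟨κ', e, h⟩ := ih (f κ) hlt κ (by simpa only [hbκ'] using hlow) rfl
    exact ⟨κ', e.trans hbκ, h⟩
  by_cases hP : IsPlaced b low ι
  · exact ⟨ι, rfl, hP⟩
  have hcase : (∃ j, low j ∧ ∃ i, i < ι j ∧ b i = b (ι j) ∧ i ∉ Set.range ι) ∨
      (∃ j, ¬ low j ∧ ∃ i, ι j < i ∧ b i = b (ι j) ∧ i ∉ Set.range ι) := by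
    by_contra hc
    push Not at hc
    exact hP ⟨hc.1, hc.2⟩
  rcases hcase with ⟨j, hj, i, hij, hbi, hi⟩ | ⟨j, hj, i, hij, hbi, hi⟩
  · obtain ⟨l, hl, hmin⟩ := Set.exists_min_image {l | i < ι l} id (Set.toFinite _) ⟨j, hij⟩
    have hlj : l ≤ j := hmin j hij
    have hbl : b i = b (ι l) :=
      le_antisymm (hb hl.le) (hbi ▸ hb (ι.monotone hlj))
    refine move l i hbl (fun k hk => ?_) (fun k hk => hl.trans (ι.strictMono hk)) (Or.inl ⟨?_, hl⟩)
    · exact lt_of_le_of_ne (not_lt.1 fun h => absurd (hmin k h) (not_le.2 hk))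
        fun e => hi ⟨k, e⟩
    · rcases hlj.eq_or_lt with rfl | h
      · exact hj
      · exact hlow l j h (hbl ▸ hbi) hj
  · obtain ⟨l, hl, hmax⟩ := Set.exists_max_image {l | ι l < i} id (Set.toFinite _) ⟨j, hij⟩
    have hlj : j ≤ l := hmax j hij
    have hbl : b i = b (ι l) :=
      le_antisymm (hbi ▸ hb (ι.monotone hlj)) (hb (le_of_lt hl))
    refine move l i hbl (fun k hk => (ι.strictMono hk).trans hl) (fun k hk => ?_)
      (Or.inr ⟨fun h' => ?_, hl⟩)
    · exact lt_of_le_of_ne (not_lt.1 fun h => absurd (hmax k h) (not_le.2 hk))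
        fun e => hi ⟨k, e.symm⟩
    · rcases hlj.eq_or_lt with rfl | h
      · exact hj h'
      · exact hj (hlow j l h (hbi ▸ hbl) h')

/-! ### The recurrence for the numbers of permutations increasing on fibres -/

/-- A bijection of the permutations onto the pairs of a permutation in a class `C` and of the places
of its letters, such that a permutation is increasing on the fibres of a monotone function `b` if
and only if its `C`-part is, and the remaining elements lie, in each fibre of `b`, just between the
low letters and the others. -/
structure DecompSystem where
  /-- The class of permutations. -/
  C : ∀ m, Set (Perm (Fin m))
  /-- The decomposition. -/
  dec : ∀ {n}, Perm (Fin n) → Decomp n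
  /-- The letters that precede the elements outside the `C`-part in their fibre. -/
  low : ∀ {m}, Perm (Fin m) → Fin m → Prop
  dec_injective : ∀ {n}, Function.Injective (dec : Perm (Fin n) → Decomp n)
  mem_range_dec : ∀ {m n} (d : Perm (Fin m)) (ι : Fin m ↪o Fin n),
    (∃ σ, dec σ = ⟨m, d, ι⟩) ↔ d ∈ C m
  low_of_lt : ∀ {m} {b : Fin m → ℕ} {d : Perm (Fin m)}, Monotone b → IncOn b d →
    ∀ j j', j < j' → b j = b j' → low d j' → low d j
  incOn_iff : ∀ {n} {b : Fin n → ℕ} (σ : Perm (Fin n)), Monotone b →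
    (IncOn b σ ↔ IncOn (b ∘ (dec σ).2.2) (dec σ).2.1 ∧ IsPlaced b (low (dec σ).2.1) (dec σ).2.2)

namespace DecompSystem

/-- The restriction of `b` to the places of the letters of the `C`-part. -/
def type (S : DecompSystem) {n : ℕ} (b : Fin n → ℕ) (σ : Perm (Fin n)) : Σ m : ℕ, Fin m → ℕ :=
  ⟨(S.dec σ).1, b ∘ (S.dec σ).2.2⟩

/-- A permutation in the class that is increasing on the fibres of `b ∘ ι` occurs with exactly one
placement in the fibres of `b`. -/
theorem card_type_eq (S : DecompSystem) {m n : ℕ} {b : Fin n → ℕ} (hb : Monotone b)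
    (ι : Fin m ↪o Fin n) :
    Nat.card {σ : {σ // IncOn b σ} // S.type b σ.1 = ⟨m, b ∘ ι⟩}
      = Nat.card {d // d ∈ S.C m ∧ IncOn (b ∘ ι) d} := by
  have hbι : Monotone (b ∘ ι) := hb.comp ι.monotone
  have hex : ∀ d : {d // d ∈ S.C m ∧ IncOn (b ∘ ι) d}, ∃ κ : Fin m ↪o Fin n,
      b ∘ κ = b ∘ ι ∧ IsPlaced b (S.low d.1) κ :=
    fun d => exists_isPlaced hb ι (S.low_of_lt hbι d.2.2)
  choose κ hκb hκ using hex
  have hσ : ∀ d, ∃ σ, S.dec σ = ⟨m, d.1, κ d⟩ := fun d => (S.mem_range_dec d.1 (κ d)).2 d.2.1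
  choose s hs using hσ
  have hinc : ∀ d, IncOn b (s d) := by
    intro d
    rw [S.incOn_iff _ hb, hs d]
    exact ⟨by dsimp only; rw [hκb d]; exact d.2.2, hκ d⟩
  have htype : ∀ d, S.type b (s d) = ⟨m, b ∘ ι⟩ := by
    intro d; unfold type; rw [hs d]; dsimp only; rw [hκb d]
  symm
  refine Nat.card_congr (Equiv.ofBijective (fun d => ⟨⟨s d, hinc d⟩, htype d⟩) ⟨?_, ?_⟩)
  · intro d d' h
    have e : s d = s d' := by simpa using h
    have e' := hs d
    rw [e, hs d'] at e'
    have e'' := (Prod.mk.inj (eq_of_heq (Sigma.mk.inj e').2)).1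
    exact Subtype.ext e''.symm
  · rintro ⟨⟨σ, hi⟩, ht⟩
    suffices h : ∃ d, s d = σ by
      obtain ⟨d, h⟩ := h
      exact ⟨d, Subtype.ext (Subtype.ext h)⟩
    have hi' := (S.incOn_iff σ hb).1 hi
    have hC : (S.dec σ).2.1 ∈ S.C (S.dec σ).1 := (S.mem_range_dec _ (S.dec σ).2.2).1 ⟨σ, rfl⟩
    dsimp only at ht
    unfold type at ht
    generalize hD : S.dec σ = D at hi' hC ht
    obtain ⟨m', d, ι'⟩ := D
    dsimp only at hi' hC ht
    obtain rfl : m' = m := (Sigma.mk.inj ht).1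
    have hbι' : b ∘ ι' = b ∘ ι := eq_of_heq (Sigma.mk.inj ht).2
    rw [hbι'] at hi'
    refine ⟨⟨d, hC, hi'.1⟩, ?_⟩
    have e : ι' = κ ⟨d, hC, hi'.1⟩ :=
      hi'.2.unique (hκ ⟨d, hC, hi'.1⟩) (hbι'.trans (hκb _).symm) fun j j' hj hbj =>
        S.low_of_lt hbι hi'.1 j j' hj (by rw [← hbι']; exact hbj)
    apply S.dec_injective
    rw [hs, hD, ← e]

end DecompSystem

/-- Two functions on a finite type whose fibres have the same cardinality at all points but one
also agree there. -/
theorem card_fiber_eq_of_forall_ne {α γ : Type*} [Finite α] (f g : α → γ) (c₀ : γ)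
    (h : ∀ c, c ≠ c₀ → Nat.card {a // f a = c} = Nat.card {a // g a = c}) :
    Nat.card {a // f a = c₀} = Nat.card {a // g a = c₀} := by
  classical
  have := Fintype.ofFinite α
  simp only [Nat.card_eq_fintype_card, Fintype.card_subtype] at *
  have hf := Finset.card_eq_sum_card_fiberwise (f := f) (s := Finset.univ)
    (t := insert c₀ (Finset.univ.image f ∪ Finset.univ.image g))
    (fun a _ => by simp)
  have hg := Finset.card_eq_sum_card_fiberwise (f := g) (s := Finset.univ)
    (t := insert c₀ (Finset.univ.image f ∪ Finset.univ.image g))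
    (fun a _ => by simp)
  rw [hf, ← Finset.add_sum_erase _ _ (Finset.mem_insert_self _ _),
    ← Finset.add_sum_erase _ _ (Finset.mem_insert_self _ _),
    Finset.sum_congr rfl fun c hc => h c (Finset.ne_of_mem_erase hc)] at hg
  omega

theorem orderEmbedding_eq_refl {n : ℕ} (ι : Fin n ↪o Fin n) : ι = RelEmbedding.refl _ := by
  have h : Function.Surjective ι := Finite.injective_iff_surjective.1 ι.injective
  apply DFunLike.coe_injective
  exact (StrictMono.range_inj ι.strictMono strictMono_id).1 (by rw [h.range_eq]; simp)

/-- Any two systems have equally many permutations in their classes that are increasing on the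
fibres of `b`: all permutations that are increasing on the fibres of `b` are counted by both systems,
and the contributions of the smaller orders agree by induction. -/
theorem DecompSystem.card_incOn_eq (S T : DecompSystem) {n : ℕ} {b : Fin n → ℕ}
    (hb : Monotone b) :
    Nat.card {d // d ∈ S.C n ∧ IncOn b d} = Nat.card {d // d ∈ T.C n ∧ IncOn b d} := by
  induction n using Nat.strong_induction_on with
  | _ n ih =>
  have hS := S.card_type_eq hb (RelEmbedding.refl _)
  have hT := T.card_type_eq hb (RelEmbedding.refl _)
  have e : b ∘ (RelEmbedding.refl (· ≤ ·) : Fin n ↪o Fin n) = b := rfl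
  rw [e] at hS hT
  rw [← hS, ← hT]
  refine card_fiber_eq_of_forall_ne (fun σ : {σ // IncOn b σ} => S.type b σ.1)
    (fun σ => T.type b σ.1) _ ?_
  rintro ⟨m, b'⟩ hne
  by_cases hι : ∃ ι : Fin m ↪o Fin n, b ∘ ι = b'
  · obtain ⟨ι, rfl⟩ := hι
    rw [S.card_type_eq hb, T.card_type_eq hb]
    rcases (le_of_orderEmbedding ι).lt_or_eq with hlt | rfl
    · exact ih m hlt (hb.comp ι.monotone)
    · rw [orderEmbedding_eq_refl ι] at hne; exact absurd rfl hne
  · have hempty : ∀ U : DecompSystem,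
        Nat.card {σ : {σ // IncOn b σ} // U.type b σ.1 = ⟨m, b'⟩} = 0 := by
      intro U
      rw [Nat.card_eq_zero]
      left
      refine ⟨fun σ => hι ?_⟩
      obtain ⟨σ, h⟩ := σ
      unfold DecompSystem.type at h
      generalize U.dec σ.1 = D at h
      obtain ⟨m', d, ι⟩ := D
      obtain rfl : m' = m := (Sigma.mk.inj h).1
      exact ⟨ι, eq_of_heq (Sigma.mk.inj h).2⟩
    rw [hempty, hempty]

/-! ### The two systems -/

/-- On a fibre of `b`, which is an interval, `σ(i) - i` is weakly increasing. -/
theorem IncOn.add_le {n : ℕ} {b : Fin n → ℕ} (hb : Monotone b) {σ : Perm (Fin n)}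
    (h : IncOn b σ) {i j : Fin n} (hij : i ≤ j) (e : b i = b j) :
    (σ i : ℕ) + j ≤ σ j + i := by
  obtain ⟨i, hi⟩ := i
  obtain ⟨j, hj⟩ := j
  rw [Fin.mk_le_mk] at hij
  induction j, hij using Nat.le_induction with
  | base => exact le_rfl
  | succ j hij ih =>
    have hbj : b ⟨j, by omega⟩ = b ⟨j + 1, hj⟩ := le_antisymm
      (hb (Fin.mk_le_mk.2 (Nat.le_succ j))) (e ▸ hb (Fin.mk_le_mk.2 hij))
    have h1 := h ⟨j, by omega⟩ ⟨j + 1, hj⟩ (Fin.mk_lt_mk.2 (Nat.lt_succ_self j)) hbj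
    have h2 := ih (by omega) (e.trans hbj.symm)
    rw [Fin.lt_def] at h1
    dsimp only at *
    omega

/-- The fixed decomposition, with the derangements. In a fibre of `b` on which `σ` is increasing,
`σ(i) - i` is weakly increasing, so that the fixed points lie between the letters with `σ(i) < i`,
which are the low ones, and those with `σ(i) > i`. -/
def fixSystem : DecompSystem where
  C m := derangements (Fin m)
  dec σ := fixDecomp σ
  low d j := d j < j
  dec_injective := by
    intro n σ σ' e
    have h := isFixDecomp_fixDecomp σ
    dsimp only at e
    rw [e] at h
    exact h.unique (isFixDecomp_fixDecomp σ')
  mem_range_dec := by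
    intro m n d ι
    constructor
    · rintro ⟨σ, e⟩
      have h := (isFixDecomp_fixDecomp σ).mem_derangements
      rw [e] at h; exact h
    · intro hd
      obtain ⟨σ, h⟩ := exists_isFixDecomp hd ι
      exact ⟨σ, h.eq_fixDecomp⟩
  low_of_lt := by
    intro m b d hb hd j j' hj e hl
    have := hd.add_le hb hj.le e
    rw [Fin.lt_def] at *
    omega
  incOn_iff := by
    intro n b σ hb
    have h := isFixDecomp_fixDecomp σ
    generalize fixDecomp σ = D at *
    obtain ⟨m, d, ι⟩ := D
    dsimp only at *
    constructor
    · intro hinc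
      refine ⟨fun j j' hj e => ?_, fun j hj i hi e => ?_, fun j hj i hi e => ?_⟩
      · have := hinc _ _ (ι.strictMono hj) e
        rwa [h.apply_emb, h.apply_emb, ι.lt_iff_lt] at this
      · by_contra hn
        have := hinc.add_le hb hi.le e
        rw [h.apply_emb, h.apply_of_notMem i hn] at this
        have := ι.strictMono hj
        rw [Fin.lt_def] at this; omega
      · by_contra hn
        have := hinc.add_le hb hi.le e.symm
        rw [h.apply_emb, h.apply_of_notMem i hn] at this
        have := ι.strictMono (lt_of_le_of_ne (not_lt.1 hj) (h.mem_derangements j).symm)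
        rw [Fin.lt_def] at this; omega
    · rintro ⟨hd, hP⟩ i i' hi e
      by_cases h1 : i ∈ Set.range ι <;> by_cases h2 : i' ∈ Set.range ι
      · obtain ⟨j, rfl⟩ := h1
        obtain ⟨j', rfl⟩ := h2
        rw [h.apply_emb, h.apply_emb, ι.lt_iff_lt]
        exact hd j j' (ι.lt_iff_lt.1 hi) e
      · obtain ⟨j, rfl⟩ := h1
        have hl : d j < j := by
          by_contra hl; exact h2 (hP.mem_of_gt j hl i' hi e.symm)
        rw [h.apply_emb, h.apply_of_notMem i' h2]
        exact (ι.strictMono hl).trans hi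
      · obtain ⟨j, rfl⟩ := h2
        have hl : ¬ d j < j := fun hl => h1 (hP.mem_of_lt j hl i hi e)
        rw [h.apply_emb, h.apply_of_notMem i h1]
        exact hi.trans_le (ι.monotone (not_lt.1 hl))
      · rw [h.apply_of_notMem i h1, h.apply_of_notMem i' h2]; exact hi

/-- The pixed decomposition of the inverse permutation, with the inverses of the desarrangements.
When `σ⁻¹` is increasing on the fibres of `b`, the pixed points of `σ` come first in each fibre, as
they are the letters of a left factor of `σ`; so no letter is low. -/
def pixSystem : DecompSystem where
  C m := {e | e⁻¹ ∈ desarrangements m}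
  dec τ := pixDecomp τ⁻¹
  low _ _ := False
  dec_injective := by
    intro n τ τ' e
    have h := isPixDecomp_pixDecomp τ⁻¹
    dsimp only at e
    rw [e] at h
    exact inv_injective (inv_injective (h.unique (isPixDecomp_pixDecomp τ'⁻¹)))
  mem_range_dec := by
    intro m n d ι
    constructor
    · rintro ⟨τ, e⟩
      have h := (isPixDecomp_pixDecomp τ⁻¹).mem_desarrangements
      rw [e] at h; exact h
    · intro hd
      obtain ⟨τ, h⟩ := exists_isPixDecomp hd ι
      exact ⟨τ, h.eq_pixDecomp⟩
  low_of_lt _ _ _ _ _ _ := id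
  incOn_iff := by
    intro n b τ hb
    have h := isPixDecomp_pixDecomp τ⁻¹
    rw [inv_inv] at h
    generalize pixDecomp τ⁻¹ = D at *
    obtain ⟨m, d, ι⟩ := D
    dsimp only at *
    constructor
    · intro hinc
      refine ⟨fun j j' hj e => ?_, fun j hj => hj.elim, fun j _ i hi e => ?_⟩
      · have := hinc _ _ (ι.strictMono hj) e
        rw [Fin.lt_def, h.apply_emb, h.apply_emb] at this
        rw [Fin.lt_def]; omega
      · by_contra hn
        have h1 := hinc _ _ hi e.symm
        have h2 := h.apply_lt_of_notMem hn
        rw [Fin.lt_def, h.apply_emb] at h1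
        omega
    · rintro ⟨hd, hP⟩ i i' hi e
      by_cases h1 : i ∈ Set.range ι <;> by_cases h2 : i' ∈ Set.range ι
      · obtain ⟨j, rfl⟩ := h1
        obtain ⟨j', rfl⟩ := h2
        have := hd j j' (ι.lt_iff_lt.1 hi) e
        rw [Fin.lt_def] at *
        rw [h.apply_emb, h.apply_emb]; omega
      · obtain ⟨j, rfl⟩ := h1
        exact absurd (hP.mem_of_gt j not_false i' hi e.symm) h2
      · have h3 := h.apply_lt_of_notMem h1
        have h4 := (h.mem_range_iff i').1 h2
        rw [Fin.lt_def]; omega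
      · exact h.lt_of_notMem i i' h1 h2 hi

/-! ### The theorem of Désarménien and Wachs -/

/-- The function counting the elements of `J` up to a position is constant between two consecutive
positions, unless `J` separates them. -/
theorem incOn_iff_DES_subset {n : ℕ} (J : Finset ℕ) (σ : Perm (Fin n)) :
    IncOn (fun i => (J.filter fun j => j ≤ (i : ℕ)).card) σ ↔ DES σ ⊆ J := by
  have hDES : ∀ i, (hi : i + 1 < n) →
      (i + 1 ∈ DES σ ↔ σ ⟨i + 1, hi⟩ < σ ⟨i, by omega⟩) := by
    intro i hi
    rw [DES, mem_wDES, length_word, Nat.add_sub_cancel, word_getD _ hi,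
      word_getD _ (show i < n by omega), Fin.lt_def]
    omega
  constructor
  · intro h i hi
    have hm := mem_wDES.1 hi
    rw [length_word] at hm
    obtain ⟨i, rfl⟩ : ∃ t, i = t + 1 := ⟨i - 1, by omega⟩
    by_contra hJ
    refine lt_asymm ((hDES i hm.2.1).1 hi) (h _ _ (Fin.mk_lt_mk.2 (Nat.lt_succ_self i)) ?_)
    dsimp only
    congr 1
    apply Finset.filter_congr
    intro j hj
    have : j ≠ i + 1 := by rintro rfl; exact hJ hj
    omega
  · rintro h ⟨i, hi⟩ ⟨j, hj⟩ hij e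
    rw [Fin.mk_lt_mk] at hij
    dsimp only at e
    have hsub : J.filter (fun k => k ≤ i) = J.filter fun k => k ≤ j :=
      Finset.eq_of_subset_of_card_le
        (Finset.monotone_filter_right J fun k _ hk => hk.trans hij.le) e.ge
    have step : ∀ k, (hk : k + 1 ≤ j) → i ≤ k → σ ⟨k, by omega⟩ < σ ⟨k + 1, by omega⟩ := by
      intro k hk hik
      refine lt_of_le_of_ne (not_lt.1 fun hlt => ?_) fun e => ?_
      · have hJ := h ((hDES k (by omega)).2 hlt)
        have : k + 1 ∈ J.filter fun k => k ≤ i := by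
          rw [hsub]; exact Finset.mem_filter.2 ⟨hJ, hk⟩
        have := (Finset.mem_filter.1 this).2
        omega
      · have := congrArg Fin.val (σ.injective e)
        simp at this
    have chain : ∀ k, (hk : k ≤ j) → i + 1 ≤ k → σ ⟨i, hi⟩ < σ ⟨k, by omega⟩ := by
      intro k hk hik
      induction k, hik using Nat.le_induction with
      | base => exact step i hk le_rfl
      | succ k hik ih => exact (ih (by omega)).trans (step k hk (by omega))
    exact chain j le_rfl hij

theorem card_filter_subset {α : Type*} [Fintype α] (f : α → Finset ℕ) (J : Finset ℕ) :
    (Finset.univ.filter fun a => f a ⊆ J).card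
      = (Finset.univ.filter fun a => f a = J).card
        + ∑ I ∈ J.ssubsets, (Finset.univ.filter fun a => f a = I).card := by
  rw [Finset.card_eq_sum_card_fiberwise (f := f) (t := J.powerset)
    (fun a ha => by simpa using ha), ← Finset.add_sum_erase _ _ (Finset.mem_powerset_self J)]
  have : ∀ I, I ⊆ J → Finset.filter (fun a => f a = I) (Finset.univ.filter fun a => f a ⊆ J)
      = Finset.univ.filter fun a => f a = I := by
    intro I hI
    ext a
    simp only [Finset.mem_filter, Finset.mem_univ, true_and, and_iff_right_iff_imp]
    rintro rfl; exact hI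
  rw [this J subset_rfl]
  congr 1
  exact Finset.sum_congr rfl fun I hI => by
    rw [this I (Finset.mem_powerset.1 (Finset.mem_of_mem_erase hI))]

theorem card_fiber_eq_of_card_subset_eq {α β : Type*} [Finite α] [Finite β] (f : α → Finset ℕ)
    (g : β → Finset ℕ)
    (h : ∀ J, Nat.card {a // f a ⊆ J} = Nat.card {b // g b ⊆ J}) (J : Finset ℕ) :
    Nat.card {a // f a = J} = Nat.card {b // g b = J} := by
  classical
  have := Fintype.ofFinite α
  have := Fintype.ofFinite β
  simp only [Nat.card_eq_fintype_card, Fintype.card_subtype] at *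
  induction J using Finset.strongInduction with
  | H J ih =>
  have h1 := h J
  rw [card_filter_subset, card_filter_subset,
    Finset.sum_congr rfl fun I hI => ih I (Finset.mem_ssubsets.1 hI)] at h1
  omega

/-- For each set `J`, as many derangements as inverses of desarrangements have the descent set
`J`. -/
theorem exists_derangements_equiv (m : ℕ) :
    ∃ E : derangements (Fin m) ≃ {e : Perm (Fin m) | e⁻¹ ∈ desarrangements m},
      ∀ d, DES (E d).1 = DES d.1 := by
  have hfib : ∀ J, Nat.card {d : derangements (Fin m) // DES d.1 = J}
      = Nat.card {e : {e : Perm (Fin m) | e⁻¹ ∈ desarrangements m} // DES e.1 = J} := by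
    refine card_fiber_eq_of_card_subset_eq (fun d : derangements (Fin m) => DES d.1)
      (fun e : {e : Perm (Fin m) | e⁻¹ ∈ desarrangements m} => DES e.1) fun J => ?_
    have hb : Monotone fun i : Fin m => (J.filter fun j => j ≤ (i : ℕ)).card :=
      fun i i' h => Finset.card_le_card
        (Finset.monotone_filter_right J fun k _ (hk : k ≤ (i : ℕ)) => hk.trans h)
    have key := fixSystem.card_incOn_eq pixSystem hb
    simp only [incOn_iff_DES_subset] at key
    refine Eq.trans ?_ (key.trans ?_)
    · exact Nat.card_congr
        (Equiv.subtypeSubtypeEquivSubtypeInter (· ∈ derangements (Fin m)) (fun d => DES d ⊆ J))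
    · exact (Nat.card_congr (Equiv.subtypeSubtypeEquivSubtypeInter
        (fun e : Perm (Fin m) => e⁻¹ ∈ desarrangements m) (fun d => DES d ⊆ J))).symm
  exact ⟨Equiv.ofFiberEquiv (f := fun d : derangements (Fin m) => DES d.1)
      (g := fun e : {e : Perm (Fin m) | e⁻¹ ∈ desarrangements m} => DES e.1)
      fun J => (Finite.card_eq.1 (hfib J)).some,
    fun d => Equiv.ofFiberEquiv_map (f := fun d : derangements (Fin m) => DES d.1)
      (g := fun e : {e : Perm (Fin m) | e⁻¹ ∈ desarrangements m} => DES e.1) _ d⟩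

/-- The bijections of Désarménien and Wachs: the inverse of the image under a bijection that
preserves descent sets, with an arbitrary value outside the derangements. -/
theorem exists_isDW : ∃ DW : ∀ m : ℕ, Perm (Fin m) → Perm (Fin m), IsDW DW := by
  classical
  choose E hE using exists_derangements_equiv
  let DW : ∀ m : ℕ, Perm (Fin m) → Perm (Fin m) := fun m d =>
    if h : d ∈ derangements (Fin m) then (E m ⟨d, h⟩).1⁻¹ else 1
  have hDW : ∀ m d, (h : d ∈ derangements (Fin m)) → DW m d = (E m ⟨d, h⟩).1⁻¹ :=
    fun m d h => dif_pos h
  refine ⟨DW, fun m => ⟨⟨fun d hd => ?_, fun d hd d' hd' e => ?_, fun k hk => ?_⟩,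
    fun d hd => ?_⟩⟩
  · rw [hDW m d hd]; exact (E m ⟨d, hd⟩).2
  · rw [hDW m d hd, hDW m d' hd'] at e
    exact congrArg Subtype.val ((E m).injective (Subtype.ext (inv_injective e)))
  · have hk' : k⁻¹ ∈ {e : Perm (Fin m) | e⁻¹ ∈ desarrangements m} := by
      rw [Set.mem_ofPred_eq, inv_inv]; exact hk
    refine ⟨((E m).symm ⟨k⁻¹, hk'⟩).1, ((E m).symm ⟨k⁻¹, hk'⟩).2, ?_⟩
    rw [hDW m _ ((E m).symm ⟨k⁻¹, hk'⟩).2, Subtype.coe_eta, Equiv.apply_symm_apply, inv_inv]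
  · rw [hDW m d hd, IDES, inv_inv, hE]

/-! ### The transformations of permutations and the commuting diagram -/

theorem mapsTo_F3w_SDer (n : ℕ) : Set.MapsTo F3w (SDer n) (SDer n) := by
  intro w hw
  rw [mem_SDer_iff] at *
  rwa [length_F3w, Pos_F3w]

theorem mapsTo_F3w_SDesar (n : ℕ) : Set.MapsTo F3w (SDesar n) (SDesar n) := by
  intro w hw
  rw [mem_SDesar_iff] at *
  rwa [length_F3w, Pos_F3w]

theorem ZDer_mem_SDer {n : ℕ} (σ : Perm (Fin n)) : ZDer σ ∈ SDer n := (bijOn_ZDer n).mapsTo trivial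

theorem ZDesar_mem_SDesar {n : ℕ} (σ : Perm (Fin n)) : ZDesar σ ∈ SDesar n :=
  (bijOn_ZDesar n).mapsTo trivial

theorem ZDer_invFun {n : ℕ} {w : List ℕ} (hw : w ∈ SDer n) :
    ZDer (Function.invFun (ZDer : Perm (Fin n) → List ℕ) w) = w := by
  obtain ⟨σ, -, h⟩ := (bijOn_ZDer n).surjOn hw
  exact Function.invFun_eq ⟨σ, h⟩

theorem invFun_ZDer {n : ℕ} (σ : Perm (Fin n)) : Function.invFun ZDer (ZDer σ) = σ :=
  Function.leftInverse_invFun ZDer_injective σ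

theorem ZDer_F3 {n : ℕ} (σ : Perm (Fin n)) : ZDer (F3 σ) = F3w (ZDer σ) :=
  ZDer_invFun (mapsTo_F3w_SDer n (ZDer_mem_SDer σ))

theorem ZDesar_F3' {n : ℕ} (σ : Perm (Fin n)) : ZDesar (F3' σ) = F3w (ZDesar σ) := by
  obtain ⟨τ, -, h⟩ := (bijOn_ZDesar n).surjOn (mapsTo_F3w_SDesar n (ZDesar_mem_SDesar σ))
  exact Function.invFun_eq ⟨τ, h⟩

theorem F3_bijective (n : ℕ) : Function.Bijective (F3 : Perm (Fin n) → Perm (Fin n)) := by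
  rw [← Finite.injective_iff_bijective]
  intro σ τ h
  apply ZDer_injective
  apply F3w_injective
  rw [← ZDer_F3, ← ZDer_F3, h]

theorem F3'_bijective (n : ℕ) : Function.Bijective (F3' : Perm (Fin n) → Perm (Fin n)) := by
  rw [← Finite.injective_iff_bijective]
  intro σ τ h
  apply ZDesar_injective
  apply F3w_injective
  rw [← ZDesar_F3', ← ZDesar_F3', h]

theorem card_Zero_eq {w w' : List ℕ} (hl : w.length = w'.length) (hP : Pos w = Pos w') :
    (Zero w).card = (Zero w').card := by
  have h1 := card_Zero_add_length_Pos w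
  have h2 := card_Zero_add_length_Pos w'
  rw [hP] at h1; omega

theorem mafz_ZDer {n : ℕ} (σ : Perm (Fin n)) : mafz (ZDer σ) = maf σ := by
  rw [mafz, Zero_ZDer, Pos_ZDer]; rfl

theorem mafz_ZDesar {n : ℕ} (σ : Perm (Fin n)) : mafz (ZDesar σ) = mag σ := by
  rw [mafz, Zero_ZDesar, Pos_ZDesar]; rfl

theorem wmaj_ZDesar {n : ℕ} (σ : Perm (Fin n)) : wmaj (ZDesar σ) = imaj σ := by
  rw [wmaj, wDES_ZDesar]; rfl

theorem F3_triplet {n : ℕ} (σ : Perm (Fin n)) :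
    (fix σ, maz σ, Der σ) = (fix (F3 σ), maf (F3 σ), Der (F3 σ)) := by
  have hP : Pos (ZDer σ) = Pos (ZDer (F3 σ)) := by rw [ZDer_F3, Pos_F3w]
  refine Prod.ext ?_ (Prod.ext ?_ ?_)
  · change (FIX σ).card = (FIX (F3 σ)).card
    rw [← Zero_ZDer, ← Zero_ZDer]
    exact card_Zero_eq (by rw [length_ZDer, length_ZDer]) hP
  · change wmaj (ZDer σ) = maf (F3 σ)
    rw [← mafz_ZDer, ZDer_F3, mafz_F3w]
  · rw [Pos_ZDer, Pos_ZDer] at hP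
    exact sigma_eq_of_word_eq hP

theorem sigma_eq_of_word_inv_eq {m m' : ℕ} {d : Perm (Fin m)} {d' : Perm (Fin m')}
    (h : word d⁻¹ = word d'⁻¹) : (⟨m, d⟩ : Σ m : ℕ, Perm (Fin m)) = ⟨m', d'⟩ := by
  have h1 := sigma_eq_of_word_eq h
  obtain rfl : m = m' := (Sigma.mk.inj h1).1
  rw [inv_injective (eq_of_heq (Sigma.mk.inj h1).2)]

theorem F3'_triplet {n : ℕ} (σ : Perm (Fin n)) :
    (pix σ, imaj σ, Desar σ) = (pix (F3' σ), mag (F3' σ), Desar (F3' σ)) := by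
  have hP : Pos (ZDesar σ) = Pos (ZDesar (F3' σ)) := by rw [ZDesar_F3', Pos_F3w]
  refine Prod.ext ?_ (Prod.ext ?_ ?_)
  · change (PIX σ).card = (PIX (F3' σ)).card
    rw [← Zero_ZDesar, ← Zero_ZDesar]
    exact card_Zero_eq (by rw [length_ZDesar, length_ZDesar]) hP
  · change imaj σ = mag (F3' σ)
    rw [← mafz_ZDesar, ZDesar_F3', mafz_F3w, wmaj_ZDesar]
  · rw [Pos_ZDesar, Pos_ZDesar] at hP
    exact sigma_eq_of_word_inv_eq hP

theorem equidistributed_of_bijective {n : ℕ} {α : Type*} {f g : Perm (Fin n) → α}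
    {F : Perm (Fin n) → Perm (Fin n)} (hF : Function.Bijective F) (h : ∀ σ, g σ = f (F σ)) :
    Equidistributed f g := fun a =>
  (Nat.card_congr ((Equiv.ofBijective F hF).subtypeEquiv fun σ => by rw [h]; rfl)).symm

section

variable {DW : ∀ m : ℕ, Perm (Fin m) → Perm (Fin m)} {n : ℕ}

/-- `FIX τ` and `DW (Der τ)` have the right sizes to be the pixed decomposition of some permutation,
so that the inverse function in `DWloc` does not take a default value. -/
theorem DWloc_spec (h : IsDW DW) (τ : Perm (Fin n)) :
    PIX (DWloc DW τ) = FIX τ ∧ Desar (DWloc DW τ) = ⟨(Der τ).1, DW (Der τ).1 (Der τ).2⟩ := by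
  have hd := (h (Der τ).1).1.mapsTo (Der_mem_derangements τ)
  have hc := card_Zero_add_length_Pos (ZDer τ)
  obtain ⟨w, hl, hZ, hP⟩ := exists_Zero_eq_Pos_eq n (FIX τ) (word (DW _ (Der τ).2)⁻¹)
    (by rw [← Zero_ZDer]; simpa only [length_ZDer] using Zero_subset (ZDer τ))
    (fun x => pos_of_mem_word)
    (by rw [Zero_ZDer, Pos_ZDer, length_word, length_ZDer] at hc; rwa [length_word])
  obtain ⟨σ, -, rfl⟩ := (bijOn_ZDesar n).surjOn (mem_SDesar_iff.2 ⟨hl, _, _, hd, hP⟩)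
  rw [Zero_ZDesar] at hZ
  rw [Pos_ZDesar] at hP
  have key : (fun σ : Perm (Fin n) => (PIX σ, Desar σ)) (DWloc DW τ)
      = (FIX τ, ⟨_, DW _ (Der τ).2⟩) :=
    Function.invFun_eq (f := fun σ : Perm (Fin n) => (PIX σ, Desar σ))
      ⟨σ, Prod.ext hZ (sigma_eq_of_word_inv_eq hP)⟩
  exact ⟨congrArg Prod.fst key, congrArg Prod.snd key⟩

theorem Zero_ZDesar_DWloc (h : IsDW DW) (τ : Perm (Fin n)) :
    Zero (ZDesar (DWloc DW τ)) = Zero (ZDer τ) := by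
  rw [Zero_ZDesar, Zero_ZDer, (DWloc_spec h τ).1]

theorem Pos_ZDesar_DWloc (h : IsDW DW) (τ : Perm (Fin n)) {m : ℕ} {d : Perm (Fin m)}
    (hd : Pos (ZDer τ) = word d) : Pos (ZDesar (DWloc DW τ)) = word (DW m d)⁻¹ := by
  rw [Pos_ZDesar, (DWloc_spec h τ).2]
  rw [Pos_ZDer] at hd
  have e : Der τ = ⟨m, d⟩ := sigma_eq_of_word_eq hd
  rw [e]

theorem wDES_Pos_ZDesar_DWloc (h : IsDW DW) (τ : Perm (Fin n)) :
    wDES (Pos (ZDesar (DWloc DW τ))) = wDES (Pos (ZDer τ)) := by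
  rw [Pos_ZDesar_DWloc h τ (Pos_ZDer τ), Pos_ZDer]
  exact (h _).2 _ (Der_mem_derangements τ)

theorem DWloc_bijective (h : IsDW DW) :
    Function.Bijective (DWloc DW : Perm (Fin n) → Perm (Fin n)) := by
  rw [← Finite.injective_iff_bijective]
  intro τ τ' e
  apply ZDer_injective
  refine eq_of_Zero_eq_of_Pos_eq (by rw [length_ZDer, length_ZDer]) ?_ ?_
  · rw [← Zero_ZDesar_DWloc h, e, Zero_ZDesar_DWloc h]
  · have h1 := (DWloc_spec h τ).2
    rw [e, (DWloc_spec h τ').2] at h1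
    rw [Pos_ZDer, Pos_ZDer]
    have hd := Der_mem_derangements τ
    have hd' := Der_mem_derangements τ'
    generalize Der τ = D at *
    generalize Der τ' = D' at *
    obtain ⟨m, d⟩ := D
    obtain ⟨m', d'⟩ := D'
    dsimp only at *
    obtain rfl : m' = m := (Sigma.mk.inj h1).1
    rw [(h m').1.injOn hd' hd (eq_of_heq (Sigma.mk.inj h1).2)]

theorem dw_ZDer (τ : Perm (Fin n)) : dw DW n (ZDer τ) = ZDesar (DWloc DW τ) := by
  rw [dw, invFun_ZDer]

theorem bijOn_dw (h : IsDW DW) : Set.BijOn (dw DW n) (SDer n) (SDesar n) := by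
  refine ⟨fun w _ => ZDesar_mem_SDesar _, fun w hw w' hw' e => ?_, fun w hw => ?_⟩
  · have := (DWloc_bijective h).injective (ZDesar_injective e)
    rw [← ZDer_invFun hw, this, ZDer_invFun hw']
  · obtain ⟨σ, -, rfl⟩ := (bijOn_ZDesar n).surjOn hw
    obtain ⟨τ, rfl⟩ := (DWloc_bijective h).surjective σ
    exact ⟨ZDer τ, ZDer_mem_SDer τ, dw_ZDer τ⟩

/-- The word transformation moves the zeros according to the descents of the positive subword only,
and `DW` preserves these descents. -/
theorem DWloc_F3 (h : IsDW DW) (τ : Perm (Fin n)) : DWloc DW (F3 τ) = F3' (DWloc DW τ) := by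
  apply ZDesar_injective
  rw [ZDesar_F3']
  refine eq_of_Zero_eq_of_Pos_eq (by rw [length_F3w, length_ZDesar, length_ZDesar]) ?_ ?_
  · rw [Zero_ZDesar_DWloc h, ZDer_F3]
    exact Zero_F3w_congr (by rw [length_ZDer, length_ZDesar]) (Zero_ZDesar_DWloc h τ).symm
      (wDES_Pos_ZDesar_DWloc h τ).symm
  · rw [Pos_F3w, Pos_ZDesar_DWloc h τ (Pos_ZDer τ)]
    exact Pos_ZDesar_DWloc h _ (by rw [ZDer_F3, Pos_F3w, Pos_ZDer])

theorem dw_F3w (h : IsDW DW) {w : List ℕ} (hw : w ∈ SDer n) :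
    dw DW n (F3w w) = F3w (dw DW n w) := by
  obtain ⟨τ, -, rfl⟩ := (bijOn_ZDer n).surjOn hw
  rw [← ZDer_F3, dw_ZDer, dw_ZDer, DWloc_F3 h, ZDesar_F3']

end

end FixMah

open FixMah in
theorem theorem1p3 (n : ℕ) :
    -- the two pairs of equidistributed triplets
    Equidistributed (fun σ : Equiv.Perm (Fin n) => (fix σ, maf σ, Der σ))
      (fun σ => (fix σ, maz σ, Der σ)) ∧
    Equidistributed (fun σ : Equiv.Perm (Fin n) => (pix σ, mag σ, Desar σ))
      (fun σ => (pix σ, imaj σ, Desar σ)) ∧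
    -- `F₃` on words permutes each shuffle class and sends `maj` to `mafz`
    (∀ (k : ℕ) (v : List ℕ), (∀ x ∈ v, 0 < x) →
      Set.BijOn F3w (Sh k v) (Sh k v) ∧ ∀ w ∈ Sh k v, mafz (F3w w) = wmaj w) ∧
    -- the vertical arrows of the diagram are bijections
    Set.BijOn (ZDer : Equiv.Perm (Fin n) → List ℕ) Set.univ (SDer n) ∧
    Set.BijOn (ZDesar : Equiv.Perm (Fin n) → List ℕ) Set.univ (SDesar n) ∧
    -- the slanted arrows are bijections, and the two lateral faces commute
    Set.BijOn F3w (SDer n) (SDer n) ∧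
    Set.BijOn F3w (SDesar n) (SDesar n) ∧
    Function.Bijective (F3 : Equiv.Perm (Fin n) → Equiv.Perm (Fin n)) ∧
    Function.Bijective (F3' : Equiv.Perm (Fin n) → Equiv.Perm (Fin n)) ∧
    (∀ σ : Equiv.Perm (Fin n), ZDer (F3 σ) = F3w (ZDer σ)) ∧
    (∀ σ : Equiv.Perm (Fin n), ZDesar (F3' σ) = F3w (ZDesar σ)) ∧
    -- `F₃` and `F₃'` carry one triplet to the other
    (∀ σ : Equiv.Perm (Fin n),
      (fix σ, maz σ, Der σ) = (fix (F3 σ), maf (F3 σ), Der (F3 σ))) ∧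
    (∀ σ : Equiv.Perm (Fin n),
      (pix σ, imaj σ, Desar σ) = (pix (F3' σ), mag (F3' σ), Desar (F3' σ))) ∧
    -- bijections `DW` exist, and the diagram commutes for each of them
    (∃ DW : ∀ m : ℕ, Equiv.Perm (Fin m) → Equiv.Perm (Fin m), IsDW DW) ∧
    ∀ DW : ∀ m : ℕ, Equiv.Perm (Fin m) → Equiv.Perm (Fin m), IsDW DW →
      Function.Bijective (DWloc DW : Equiv.Perm (Fin n) → Equiv.Perm (Fin n)) ∧
      (∀ τ : Equiv.Perm (Fin n), PIX (DWloc DW τ) = FIX τ ∧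
        Desar (DWloc DW τ) = ⟨(Der τ).1, DW (Der τ).1 (Der τ).2⟩) ∧
      Set.BijOn (dw DW n) (SDer n) (SDesar n) ∧
      (∀ w ∈ SDer n, ∀ (m : ℕ), ∀ d ∈ derangements (Fin m), Pos w = word d →
        Zero (dw DW n w) = Zero w ∧ Pos (dw DW n w) = word (DW m d)⁻¹) ∧
      (∀ τ : Equiv.Perm (Fin n), dw DW n (ZDer τ) = ZDesar (DWloc DW τ)) ∧
      (∀ w ∈ SDer n, dw DW n (F3w w) = F3w (dw DW n w)) ∧
      (∀ τ : Equiv.Perm (Fin n), DWloc DW (F3 τ) = F3' (DWloc DW τ)) := by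
  refine ⟨equidistributed_of_bijective (F3_bijective n) F3_triplet,
    equidistributed_of_bijective (F3'_bijective n) F3'_triplet,
    fun k v hv => ⟨bijOn_F3w_of_finite (finite_Sh k v) (mapsTo_F3w_Sh hv), fun w _ => mafz_F3w w⟩,
    bijOn_ZDer n, bijOn_ZDesar n,
    bijOn_F3w_of_finite ?_ (mapsTo_F3w_SDer n), bijOn_F3w_of_finite ?_ (mapsTo_F3w_SDesar n),
    F3_bijective n, F3'_bijective n, ZDer_F3, ZDesar_F3', F3_triplet, F3'_triplet, exists_isDW,
    fun DW h => ⟨DWloc_bijective h, DWloc_spec h, bijOn_dw h, fun w hw m d _ hP => ?_, dw_ZDer,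
      fun w hw => dw_F3w h hw, DWloc_F3 h⟩⟩
  · rw [← (bijOn_ZDer n).image_eq]; exact Set.toFinite _
  · rw [← (bijOn_ZDesar n).image_eq]; exact Set.toFinite _
  · obtain ⟨τ, -, rfl⟩ := (bijOn_ZDer n).surjOn hw
    rw [dw_ZDer]
    exact ⟨Zero_ZDesar_DWloc h τ, Pos_ZDesar_DWloc h τ hP⟩
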